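/- An $\mathbb{R}$-tree is a metric space $T$ such that (1) for all $a,b\in T$ there is a unique isometry $\phi_{ab}:[0,d(a,b)]\to T$ with $\phi_{ab}(0)=a$ and $\phi_{ab}(d(a,b))=b$, and (2) every injective continuous map $\varphi:[0,1]\to T$ has the same range as $\phi_{\varphi(0)\varphi(1)}$. Write $[a,b]$ for the range of $\phi_{ab}$ and $[a,b[\,=[a,b]\setminus\{b\}$. A branching point of $T$ is a point $t$ such that $T\setminus\{t\}$ has at least three connected components. A set $B\subset T$ is called measurable if $\phi_{xy}^{-1}(B)$ is Lebesgue measurable for all $x,y\in T$, and its length measure is $$\lambda_T(B)=\sup\ \sum_{k=1}^n\lambda\big(\phi_{x_ky_k}^{-1}(B)\big),$$ where $\lambda$ is Lebesgue measure and the supremum is over all finite families of pairwise disjoint segments $[x_1,y_1],\dots,[x_n,y_n]$. For a metric space $M$ with base point $0$, let $\mathrm{Lip}_0(M)$ be the space of real-valued Lipschitz functions on $M$ vanishing at $0$, normed by the best Lipschitz constant, and let $\mathcal F(M)\subset \mathrm{Lip}_0(M)^*$ be the closed linear span of the evaluation functionals $\delta_x:f\mapsto f(x)$, $x\in M$. **Theorem.**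 Let $T$ be an $\mathbb{R}$-tree and let $A\subset T$ be a subset whose closure $\bar A$ contains all branching points of $T$. Choose any point $0\in A$ as base point of $A$ and as root of $T$. Let $$\mu=\mu_{\bar A}=\lambda_T|_{\bar A}+\sum_{a\in\bar A}L(a)\,\delta_a,\qquad L(a)=\inf_{x\in\bar A\cap[0,a[}d(a,x)\ \ (a\ne0),\qquad L(0)=0,$$ where in this formula $\delta_a$ is the Dirac mass at $a$. Then $\mathcal F(A)$ is linearly isometric to $L_1(\mu)$. More precisely, every $g\in L_\infty(\mu)$ is $\mu$-integrable on $[0,a]$ for each $a\in A$; the formula $$\Phi(g)(a)=\int_{[0,a]}g\,d\mu\qquad(g\in L_\infty(\mu),\ a\in A)$$ defines a linear isometry $\Phi$ of $L_\infty(\mu)$ onto $\mathrm{Lip}_0(A)$; and there is a linear isometry $J$ of $\mathcal F(A)$ onto $L_1(\mu)$ of which $\Phi$ is the transpose, that is, $$\alpha(\Phi(g))=\int_T J(\alpha)\,g\,d\mu\qquad\text{for all }\alpha\in\mathcal F(A),\ g\in L_\infty(\mu).$$ -/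

import Mathlib

open Set MeasureTheory Topology
open scoped ENNReal NNReal

/-- An `ℝ`-tree: any two points are joined by a unique isometric copy of a compact interval, and
every injective path has the same range as the isometric segment joining its endpoints. -/
class RTree (T : Type*) [MetricSpace T] : Prop where
  existsUnique_isometry : ∀ a b : T, ∃! φ : Icc (0 : ℝ) (dist a b) → T,
    Isometry φ ∧ φ ⟨0, left_mem_Icc.2 dist_nonneg⟩ = a ∧
      φ ⟨dist a b, right_mem_Icc.2 dist_nonneg⟩ = b
  range_eq_of_injective : ∀ ψ : Icc (0 : ℝ) 1 → T, Continuous ψ → Function.Injective ψ →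
    ∀ φ : Icc (0 : ℝ) (dist (ψ 0) (ψ 1)) → T, Isometry φ →
      φ ⟨0, left_mem_Icc.2 dist_nonneg⟩ = ψ 0 →
      φ ⟨dist (ψ 0) (ψ 1), right_mem_Icc.2 dist_nonneg⟩ = ψ 1 → range ψ = range φ

namespace RTree

noncomputable section

section Segments

variable {T : Type*} [MetricSpace T] [RTree T]

/-- The unique isometry `φ_{xy} : [0, d(x,y)] → T` from `x` to `y`. -/
def geod (x y : T) : Icc (0 : ℝ) (dist x y) → T :=
  (existsUnique_isometry x y).choose

/-- The segment `[x, y]`. -/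
def seg (x y : T) : Set T := range (geod x y)

/-- The parameters `t ∈ [0, d(x,y)]` with `φ_{xy}(t) ∈ A`, as a set of real numbers. -/
def params (x y : T) (A : Set T) : Set ℝ := Subtype.val '' (geod x y ⁻¹' A)

/-- `λ_{[x,y]}(A)`, the Lebesgue measure of `φ_{xy}⁻¹(A)`. -/
def segLength (x y : T) (A : Set T) : ℝ≥0∞ := volume (params x y A)

theorem geod_isometry (x y : T) : Isometry (geod x y) :=
  (existsUnique_isometry x y).choose_spec.1.1

theorem geod_left (x y : T) : geod x y ⟨0, left_mem_Icc.2 dist_nonneg⟩ = x :=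
  (existsUnique_isometry x y).choose_spec.1.2.1

theorem geod_right (x y : T) : geod x y ⟨dist x y, right_mem_Icc.2 dist_nonneg⟩ = y :=
  (existsUnique_isometry x y).choose_spec.1.2.2

theorem geod_unique (x y : T) (φ : Icc (0 : ℝ) (dist x y) → T) (h : Isometry φ)
    (h0 : φ ⟨0, left_mem_Icc.2 dist_nonneg⟩ = x)
    (h1 : φ ⟨dist x y, right_mem_Icc.2 dist_nonneg⟩ = y) : φ = geod x y :=
  (existsUnique_isometry x y).choose_spec.2 φ ⟨h, h0, h1⟩

theorem left_mem_seg (x y : T) : x ∈ seg x y := ⟨_, geod_left x y⟩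

theorem params_subset (x y : T) (A : Set T) : params x y A ⊆ Icc 0 (dist x y) := by
  rintro _ ⟨t, -, rfl⟩
  exact t.2

theorem mem_params {x y : T} {A : Set T} {t : ℝ} (ht : t ∈ Icc 0 (dist x y)) :
    t ∈ params x y A ↔ geod x y ⟨t, ht⟩ ∈ A := by
  constructor
  · rintro ⟨s, hs, rfl⟩
    exact hs
  · intro h
    exact ⟨⟨t, ht⟩, h, rfl⟩

theorem params_mono (x y : T) {A B : Set T} (h : A ⊆ B) : params x y A ⊆ params x y B :=
  image_mono (preimage_mono h)

theorem params_compl (x y : T) (A : Set T) :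
    params x y Aᶜ = Icc 0 (dist x y) \ params x y A := by
  ext t
  constructor
  · intro h
    have ht := params_subset _ _ _ h
    exact ⟨ht, fun h' => ((mem_params ht).1 h) ((mem_params ht).1 h')⟩
  · rintro ⟨ht, h⟩
    exact (mem_params ht).2 fun h' => h ((mem_params ht).2 h')

theorem params_iUnion {ι : Type*} (x y : T) (A : ι → Set T) :
    params x y (⋃ i, A i) = ⋃ i, params x y (A i) := by
  simp only [params, preimage_iUnion, image_iUnion]

theorem params_disjoint (x y : T) {A B : Set T} (h : Disjoint A B) :
    Disjoint (params x y A) (params x y B) :=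
  (disjoint_image_iff Subtype.val_injective).2 (h.preimage _)

theorem params_isClosed (x y : T) {A : Set T} (h : IsClosed A) : IsClosed (params x y A) :=
  isClosed_Icc.isClosedEmbedding_subtypeVal.isClosedMap _
    (h.preimage (geod_isometry x y).continuous)

/-- A subset `A` of `T` is measurable when every `φ_{xy}⁻¹(A)` is Lebesgue measurable. -/
instance measurableSpace : MeasurableSpace T where
  MeasurableSet' A := ∀ x y : T, NullMeasurableSet (params x y A) volume
  measurableSet_empty x y := by simp [params]
  measurableSet_compl A h x y := by
    rw [params_compl]
    exact measurableSet_Icc.nullMeasurableSet.diff (h x y)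
  measurableSet_iUnion A h x y := by
    rw [params_iUnion]
    exact NullMeasurableSet.iUnion fun i => h i x y

/-- A finite family of pairwise disjoint segments (given by their pairs of endpoints); its union
is a typical element of the set `𝓡`. -/
def IsDisjointFamily (R : Finset (T × T)) : Prop :=
  (R : Set (T × T)).PairwiseDisjoint fun p => seg p.1 p.2

/-- The length `λ_T(A)`, the supremum of `λ_R(A) = ∑ₖ λ_{Sₖ}(A)` over all finite disjoint unions
`R = ⋃ₖ Sₖ` of segments. -/
def length (A : Set T) : ℝ≥0∞ :=
  ⨆ (R : Finset (T × T)) (_ : IsDisjointFamily R), ∑ p ∈ R, segLength p.1 p.2 A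

/-! Countable additivity of `length` on the measurable sets. -/

theorem geod_sub (x y : T) {s t : ℝ} (hs : s ∈ Icc 0 (dist x y)) (ht : t ∈ Icc 0 (dist x y))
    (hst : s ≤ t) :
    seg (geod x y ⟨s, hs⟩) (geod x y ⟨t, ht⟩) = geod x y '' (Subtype.val ⁻¹' Icc s t) ∧
    ∀ A, segLength (geod x y ⟨s, hs⟩) (geod x y ⟨t, ht⟩) A
      = volume (params x y A ∩ Icc s t) := by
  set u := geod x y ⟨s, hs⟩ with hu
  set v := geod x y ⟨t, ht⟩ with hv
  have hd : dist u v = t - s := by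
    rw [hu, hv, (geod_isometry x y).dist_eq, Subtype.dist_eq, Real.dist_eq, abs_sub_comm,
      abs_of_nonneg (sub_nonneg.2 hst)]
  have hmem : ∀ w : Icc (0 : ℝ) (dist u v), s + w.1 ∈ Icc 0 (dist x y) := by
    rintro ⟨w, h0, h1⟩
    rw [hd] at h1
    exact ⟨add_nonneg hs.1 h0, by linarith [ht.2]⟩
  have hg : (fun w : Icc (0 : ℝ) (dist u v) => geod x y ⟨s + w.1, hmem w⟩) = geod u v := by
    apply geod_unique
    · refine Isometry.of_dist_eq fun a b => ?_
      rw [(geod_isometry x y).dist_eq, Subtype.dist_eq, Subtype.dist_eq]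
      exact dist_add_left _ _ _
    · simp [hu]
    · have h : ∀ r : ℝ, ∀ h : s + r ∈ Icc 0 (dist x y), r = t - s →
          geod x y ⟨s + r, h⟩ = geod x y ⟨t, ht⟩ := by
        rintro r h rfl
        simp
      exact h _ _ hd
  constructor
  · rw [seg, ← hg]
    ext z
    constructor
    · rintro ⟨w, rfl⟩
      refine ⟨_, ?_, rfl⟩
      have h1 := w.2.1
      have h2 := w.2.2.trans_eq hd
      exact ⟨by simpa using h1, by simpa using by linarith⟩
    · rintro ⟨⟨r, hr⟩, hr', rfl⟩
      refine ⟨⟨r - s, ?_⟩, ?_⟩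
      · rw [hd]
        exact ⟨by linarith [hr'.1], by linarith [hr'.2]⟩
      · simp
  · intro A
    have : params x y A ∩ Icc s t = (fun r => s + r) '' params u v A := by
      ext r
      constructor
      · rintro ⟨hr, hr'⟩
        have hrI := params_subset _ _ _ hr
        have hm : r - s ∈ Icc 0 (dist u v) := by
          rw [hd]
          exact ⟨by linarith [hr'.1], by linarith [hr'.2]⟩
        refine ⟨r - s, (mem_params hm).2 ?_, by simp⟩
        rw [← hg]
        have := (mem_params hrI).1 hr
        simpa using this
      · rintro ⟨w, hw, rfl⟩
        have hwI := params_subset _ _ _ hw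
        have h := (mem_params hwI).1 hw
        rw [← hg] at h
        refine ⟨(mem_params (hmem ⟨w, hwI⟩)).2 h, ?_⟩
        rw [hd] at hwI
        exact ⟨by simpa using hwI.1, by simpa using by linarith [hwI.2]⟩
    rw [this, segLength, image_add_left, measure_preimage_add]

/-- The supremum defining `length A`, restricted to the families of segments contained in `U`. -/
def lengthIn (U A : Set T) : ℝ≥0∞ :=
  ⨆ (R : Finset (T × T)) (_ : IsDisjointFamily R ∧ ∀ p ∈ R, seg p.1 p.2 ⊆ U),
    ∑ p ∈ R, segLength p.1 p.2 A

theorem le_lengthIn {U A : Set T} {R : Finset (T × T)} (h : IsDisjointFamily R)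
    (h' : ∀ p ∈ R, seg p.1 p.2 ⊆ U) : ∑ p ∈ R, segLength p.1 p.2 A ≤ lengthIn U A :=
  le_iSup₂_of_le R ⟨h, h'⟩ le_rfl

theorem segLength_mono (x y : T) {A B : Set T} (h : A ⊆ B) : segLength x y A ≤ segLength x y B :=
  measure_mono (params_mono x y h)

theorem lengthIn_mono {U V A B : Set T} (hU : U ⊆ V) (h : A ⊆ B) :
    lengthIn U A ≤ lengthIn V B := by
  refine iSup₂_le fun R hR => ?_
  exact (Finset.sum_le_sum fun p _ => segLength_mono _ _ h).trans
    (le_lengthIn hR.1 fun p hp => (hR.2 p hp).trans hU)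

theorem lengthIn_le_length (U A : Set T) : lengthIn U A ≤ length A :=
  iSup₂_le fun R hR => le_iSup₂_of_le R hR.1 le_rfl

theorem lengthIn_add_le {U V W A : Set T} (hUV : Disjoint U V) (hU : U ⊆ W) (hV : V ⊆ W) :
    lengthIn U A + lengthIn V A ≤ lengthIn W A := by
  classical
  refine ENNReal.iSup_add_iSup_le fun R R' => ?_
  by_cases hR : IsDisjointFamily R ∧ ∀ p ∈ R, seg p.1 p.2 ⊆ U
  swap
  · simp only [hR, iSup_false, bot_eq_zero, zero_add]
    exact iSup_le fun h => le_lengthIn h.1 fun p hp => (h.2 p hp).trans hV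
  by_cases hR' : IsDisjointFamily R' ∧ ∀ p ∈ R', seg p.1 p.2 ⊆ V
  swap
  · simp only [hR', iSup_false, bot_eq_zero, add_zero]
    exact iSup_le fun h => le_lengthIn h.1 fun p hp => (h.2 p hp).trans hU
  rw [iSup_pos hR, iSup_pos hR']
  have hc : ∀ p ∈ R, ∀ q ∈ R', Disjoint (seg p.1 p.2) (seg q.1 q.2) := fun p hp q hq =>
    hUV.mono (hR.2 p hp) (hR'.2 q hq)
  have hd : Disjoint R R' := by
    rw [Finset.disjoint_left]
    intro p hp hp'
    exact (hc p hp p hp').le_bot ⟨left_mem_seg _ _, left_mem_seg _ _⟩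
  rw [← Finset.sum_union hd]
  refine le_lengthIn ?_ ?_
  · rw [IsDisjointFamily, Finset.coe_union, Set.pairwiseDisjoint_union]
    exact ⟨hR.1, hR'.1, fun p hp q hq _ => hc p hp q hq⟩
  · intro p hp
    rcases Finset.mem_union.1 hp with hp | hp
    · exact (hR.2 p hp).trans hU
    · exact (hR'.2 p hp).trans hV

theorem segLength_le_lengthIn (x y : T) {K U : Set T} (hU : IsOpen U) (hKU : K ⊆ U) :
    segLength x y K ≤ lengthIn U K := by
  classical
  set d := dist x y with hd
  set s : Set ℝ := params x y K ∩ Ioo 0 d with hs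
  have hS : segLength x y K ≤ volume s := by
    have hsub : params x y K ⊆ s ∪ {0, d} := by
      intro t ht
      have htI := params_subset _ _ _ ht
      rcases eq_or_lt_of_le htI.1 with h0 | h0
      · exact Or.inr (Or.inl h0.symm)
      rcases eq_or_lt_of_le htI.2 with h1 | h1
      · exact Or.inr (Or.inr h1)
      exact Or.inl ⟨ht, h0, h1⟩
    calc segLength x y K ≤ volume (s ∪ {0, d}) := measure_mono hsub
      _ ≤ volume s + volume ({0, d} : Set ℝ) := measure_union_le _ _
      _ = volume s := by
        rw [(Set.toFinite ({0, d} : Set ℝ)).measure_zero, add_zero]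
  have hR : ∀ t ∈ s, ∃ ε > 0, Metric.closedBall t ε ⊆ params x y U ∩ Ioo 0 d := by
    rintro t ⟨ht, htI⟩
    have hO : IsOpen (params x y U ∩ Ioo 0 d) := by
      have : params x y U ∩ Ioo 0 d = Ioo 0 d \ params x y Uᶜ := by
        rw [params_compl]
        ext r
        constructor
        · rintro ⟨h, h'⟩
          exact ⟨h', fun h'' => h''.2 h⟩
        · rintro ⟨h', h⟩
          refine ⟨?_, h'⟩
          by_contra hn
          exact h ⟨Ioo_subset_Icc_self h', hn⟩
      rw [this]
      exact isOpen_Ioo.sdiff (params_isClosed x y hU.isClosed_compl)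
    exact Metric.nhds_basis_closedBall.mem_iff.1
      (hO.mem_nhds ⟨params_mono x y hKU ht, htI⟩)
  choose! ρ hρ hρs using hR
  obtain ⟨t, r, htc, hts, hr, hcov, hdis⟩ :=
    Besicovitch.exists_disjoint_closedBall_covering_ae (volume : Measure ℝ) (fun _ => Ioi 0) s
      (fun _ _ δ hδ => ⟨δ / 2, half_pos hδ, half_pos hδ, half_lt_self hδ⟩) ρ hρ
  have hball : ∀ a ∈ t, Metric.closedBall a (r a) ⊆ params x y U ∩ Ioo 0 d := fun a ha =>
    (Metric.closedBall_subset_closedBall (hr a ha).2.2.le).trans (hρs a (hts ha))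
  have hrpos : ∀ a ∈ t, 0 < r a := fun a ha => (hr a ha).1
  have hl : ∀ a ∈ t, a - r a ∈ Icc 0 (dist x y) := fun a ha =>
    Ioo_subset_Icc_self (hball a ha (by
      rw [Real.closedBall_eq_Icc]; exact ⟨le_rfl, by linarith [hrpos a ha]⟩)).2
  have hr' : ∀ a ∈ t, a + r a ∈ Icc 0 (dist x y) := fun a ha =>
    Ioo_subset_Icc_self (hball a ha (by
      rw [Real.closedBall_eq_Icc]; exact ⟨by linarith [hrpos a ha], le_rfl⟩)).2
  let e : t → T × T := fun a =>
    (geod x y ⟨a.1 - r a.1, hl a.1 a.2⟩, geod x y ⟨a.1 + r a.1, hr' a.1 a.2⟩)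
  have he : ∀ a : t, seg (e a).1 (e a).2
        = geod x y '' (Subtype.val ⁻¹' Metric.closedBall a.1 (r a.1)) ∧
      segLength (e a).1 (e a).2 K
        = volume (params x y K ∩ Metric.closedBall a.1 (r a.1)) := by
    intro a
    have := geod_sub x y (hl a.1 a.2) (hr' a.1 a.2) (by linarith [hrpos a.1 a.2])
    rw [Real.closedBall_eq_Icc]
    exact ⟨this.1, this.2 K⟩
  have hedis : ∀ a b : t, a ≠ b → Disjoint (seg (e a).1 (e a).2) (seg (e b).1 (e b).2) := by
    intro a b hab
    rw [(he a).1, (he b).1, disjoint_image_iff (geod_isometry x y).injective]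
    exact (hdis a.2 b.2 fun h => hab (Subtype.ext h)).preimage _
  have heinj : Function.Injective e := by
    intro a b hab
    by_contra hne
    have := hedis a b hne
    rw [hab] at this
    exact this.le_bot ⟨left_mem_seg _ _, left_mem_seg _ _⟩
  have : Countable t := htc.to_subtype
  calc segLength x y K ≤ volume s := hS
    _ ≤ volume (s \ ⋃ a ∈ t, Metric.closedBall a (r a))
        + volume (⋃ a : t, params x y K ∩ Metric.closedBall a.1 (r a.1)) := by
      refine (measure_mono ?_).trans (measure_union_le _ _)
      intro z hz
      by_cases h : z ∈ ⋃ a ∈ t, Metric.closedBall a (r a)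
      · right
        simp only [mem_iUnion] at h ⊢
        obtain ⟨a, ha, hza⟩ := h
        exact ⟨⟨a, ha⟩, hz.1, hza⟩
      · exact Or.inl ⟨hz, h⟩
    _ ≤ ∑' a : t, volume (params x y K ∩ Metric.closedBall a.1 (r a.1)) := by
      rw [hcov, zero_add]
      exact measure_iUnion_le _
    _ = ∑' a : t, segLength (e a).1 (e a).2 K := by simp only [(he _).2]
    _ ≤ lengthIn U K := by
      rw [ENNReal.tsum_eq_iSup_sum]
      refine iSup_le fun F => ?_
      rw [← Finset.sum_image (f := fun p : T × T => segLength p.1 p.2 K) heinj.injOn]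
      refine le_lengthIn ?_ ?_
      · intro p hp q hq hpq
        obtain ⟨a, -, rfl⟩ := Finset.mem_image.1 hp
        obtain ⟨b, -, rfl⟩ := Finset.mem_image.1 hq
        exact hedis a b fun h => hpq (by rw [h])
      · intro p hp
        obtain ⟨a, -, rfl⟩ := Finset.mem_image.1 hp
        rw [(he a).1]
        rintro _ ⟨z, hz, rfl⟩
        exact (mem_params z.2).1 (hball a.1 a.2 hz).1

/-- An inner regularised form of `length`. -/
def innerLength (A : Set T) : ℝ≥0∞ :=
  ⨆ (K : Set T) (_ : IsCompact K ∧ K ⊆ A), ⨅ (U : Set T) (_ : IsOpen U ∧ K ⊆ U), lengthIn U K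

theorem innerLength_le_length (A : Set T) : innerLength A ≤ length A := by
  refine iSup₂_le fun K hK => ?_
  refine (iInf₂_le univ ⟨isOpen_univ, subset_univ _⟩).trans ?_
  exact (lengthIn_mono le_rfl hK.2).trans (lengthIn_le_length _ _)

theorem innerLength_mono {A B : Set T} (h : A ⊆ B) : innerLength A ≤ innerLength B :=
  iSup₂_le fun K hK => le_iSup₂_of_le K ⟨hK.1, hK.2.trans h⟩ le_rfl

theorem innerLength_add_le {A B : Set T} (h : Disjoint A B) :
    innerLength A + innerLength B ≤ innerLength (A ∪ B) := by
  refine ENNReal.biSup_add_biSup_le' (p := fun K : Set T => IsCompact K ∧ K ⊆ A)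
    (q := fun K : Set T => IsCompact K ∧ K ⊆ B) ⟨∅, isCompact_empty, empty_subset _⟩
    ⟨∅, isCompact_empty, empty_subset _⟩ ?_
  intro K hK K' hK'
  refine le_iSup₂_of_le (K ∪ K') ⟨hK.1.union hK'.1, union_subset_union hK.2 hK'.2⟩ ?_
  refine le_iInf₂ fun W hW => ?_
  obtain ⟨U, V, hU, hV, hKU, hKV, hUV⟩ :=
    SeparatedNhds.of_isCompact_isCompact hK.1 hK'.1 (h.mono hK.2 hK'.2)
  have hKW := subset_union_left.trans hW.2
  have hKW' := subset_union_right.trans hW.2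
  calc _ ≤ lengthIn (U ∩ W) K + lengthIn (V ∩ W) K' :=
        add_le_add (iInf₂_le _ ⟨hU.inter hW.1, subset_inter hKU hKW⟩)
          (iInf₂_le _ ⟨hV.inter hW.1, subset_inter hKV hKW'⟩)
    _ ≤ lengthIn (U ∩ W) (K ∪ K') + lengthIn (V ∩ W) (K ∪ K') :=
        add_le_add (lengthIn_mono le_rfl subset_union_left)
          (lengthIn_mono le_rfl subset_union_right)
    _ ≤ lengthIn W (K ∪ K') :=
        lengthIn_add_le (hUV.mono inter_subset_left inter_subset_left) inter_subset_right
          inter_subset_right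

theorem segLength_le_innerLength (x y : T) {A : Set T} (hA : MeasurableSet A) :
    segLength x y A ≤ innerLength (A ∩ seg x y) := by
  obtain ⟨t, hts, htm, hte⟩ := NullMeasurableSet.exists_measurable_subset_ae_eq (hA x y)
  rw [segLength, ← measure_congr hte, htm.measure_eq_iSup_isCompact]
  refine iSup₂_le fun C hC => iSup_le fun hCc => ?_
  have hCI : C ⊆ Icc 0 (dist x y) := (hC.trans hts).trans (params_subset x y A)
  set K : Set T := geod x y '' (Subtype.val ⁻¹' C) with hK
  have hKc : IsCompact K :=
    (isClosed_Icc.isClosedEmbedding_subtypeVal.isCompact_preimage hCc).image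
      (geod_isometry x y).continuous
  have hKA : K ⊆ A ∩ seg x y := by
    rintro _ ⟨z, hz, rfl⟩
    exact ⟨(mem_params z.2).1 (hts (hC hz)), mem_range_self _⟩
  refine le_iSup₂_of_le K ⟨hKc, hKA⟩ (le_iInf₂ fun U hU => ?_)
  refine le_trans (measure_mono ?_) (segLength_le_lengthIn x y hU.1 hU.2)
  intro c hc
  exact (mem_params (hCI hc)).2 ⟨⟨c, hCI hc⟩, hc, rfl⟩

theorem length_eq_innerLength {A : Set T} (hA : MeasurableSet A) : length A = innerLength A := by
  classical
  refine le_antisymm (iSup₂_le fun R hR => ?_) (innerLength_le_length A)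
  have key : ∀ F : Finset (T × T), F ⊆ R →
      ∑ p ∈ F, segLength p.1 p.2 A ≤ innerLength (A ∩ ⋃ p ∈ F, seg p.1 p.2) := by
    intro F
    induction F using Finset.induction_on with
    | empty => simp
    | insert p F hp ih =>
      intro hF
      rw [Finset.sum_insert hp]
      refine (add_le_add (segLength_le_innerLength p.1 p.2 hA)
        (ih ((Finset.subset_insert _ _).trans hF))).trans ?_
      refine (innerLength_add_le ?_).trans (innerLength_mono ?_)
      · refine Disjoint.mono inter_subset_right inter_subset_right ?_
        simp only [disjoint_iUnion_right]
        intro q hq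
        exact hR (hF (Finset.mem_insert_self _ _)) (hF (Finset.mem_insert_of_mem hq))
          (fun h => hp (h ▸ hq))
      · rw [← inter_union_distrib_left, Finset.set_biUnion_insert]
  exact (key R subset_rfl).trans (innerLength_mono inter_subset_left)

theorem length_mono {A B : Set T} (h : A ⊆ B) : length A ≤ length B :=
  iSup₂_le fun R hR => le_iSup₂_of_le R hR (Finset.sum_le_sum fun _ _ => segLength_mono _ _ h)

theorem length_empty : length (∅ : Set T) = 0 := by
  simp [length, segLength, params]

theorem length_add_le {A B : Set T} (hA : MeasurableSet A) (hB : MeasurableSet B)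
    (h : Disjoint A B) : length A + length B ≤ length (A ∪ B) := by
  rw [length_eq_innerLength hA, length_eq_innerLength hB]
  exact (innerLength_add_le h).trans (innerLength_le_length _)

theorem length_iUnion (A : ℕ → Set T) (hA : ∀ i, MeasurableSet (A i))
    (hd : Pairwise (Function.onFun Disjoint A)) : length (⋃ i, A i) = ∑' i, length (A i) := by
  refine le_antisymm (iSup₂_le fun R hR => ?_) ?_
  · have : ∀ p ∈ R, segLength p.1 p.2 (⋃ i, A i) = ∑' i, segLength p.1 p.2 (A i) := by
      intro p _
      rw [segLength, params_iUnion, measure_iUnion₀]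
      · rfl
      · exact fun i j hij => (params_disjoint _ _ (hd hij)).aedisjoint
      · exact fun i => hA i p.1 p.2
    rw [Finset.sum_congr rfl this, ← Summable.tsum_finsetSum fun _ _ => ENNReal.summable]
    exact ENNReal.tsum_le_tsum fun i => le_iSup₂_of_le R hR le_rfl
  · rw [ENNReal.tsum_eq_iSup_sum]
    refine iSup_le fun F => ?_
    have key : ∑ i ∈ F, length (A i) ≤ length (⋃ i ∈ F, A i) := by
      induction F using Finset.induction_on with
      | empty => simp
      | insert j F hj ih =>
        rw [Finset.sum_insert hj, Finset.set_biUnion_insert]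
        refine (add_le_add le_rfl ih).trans (length_add_le (hA j)
          (F.measurableSet_biUnion fun i _ => hA i) ?_)
        simp only [disjoint_iUnion_right]
        exact fun i hi => hd fun h => hj (h ▸ hi)
    exact key.trans (length_mono (iUnion₂_subset fun i _ => subset_iUnion A i))

variable (T) in
/-- The length measure `λ_T`. -/
def lengthMeasure : Measure T :=
  Measure.ofMeasurable (fun A _ => length A) length_empty fun A hA hd => length_iUnion A hA hd

theorem lengthMeasure_apply {A : Set T} (hA : MeasurableSet A) : lengthMeasure T A = length A :=
  Measure.ofMeasurable_apply A hA

open Classical in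
/-- `L(a) = inf {d(a, x) : x ∈ A ∩ [o, a[}`, for the root `o`. At `a = o` the index set is empty
and `L(o) = 0`: the root carries no mass. -/
def rootGap (o : T) (A : Set T) (a : T) : ℝ :=
  if a = o then 0 else sInf (dist a '' (A ∩ (seg o a \ {a})))

/-- The measure `μ_A = λ_A + ∑_{a ∈ A} L(a) δ_a` on the `ℝ`-tree `T` with root `o`. -/
def treeMeasure (o : T) (A : Set T) : Measure T :=
  (lengthMeasure T).restrict A +
    Measure.sum fun a : A => ENNReal.ofReal (rootGap o A a) • Measure.dirac (a : T)

end Segments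

/-- The branching points: those whose complement has at least three connected components. -/
def branchingPoints (T : Type*) [MetricSpace T] : Set T :=
  {t | 3 ≤ ENat.card (ConnectedComponents ({t}ᶜ : Set T))}

end

end RTree

noncomputable section

section LipschitzFree

variable {M : Type*} [MetricSpace M]

/-- The real-valued Lipschitz functions on `M` vanishing at the base point `o`, as a subspace of
all functions. -/
def lipSubmodule (M : Type*) [MetricSpace M] (o : M) : Submodule ℝ (M → ℝ) where
  carrier := {f | f o = 0 ∧ ∃ K : ℝ, 0 ≤ K ∧ ∀ x y, |f y - f x| ≤ K * dist x y}
  zero_mem' := ⟨rfl, 0, le_rfl, fun x y => by simp⟩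
  add_mem' := by
    rintro f g ⟨hf, K, hK, hfK⟩ ⟨hg, K', hK', hgK⟩
    refine ⟨by simp [hf, hg], K + K', add_nonneg hK hK', fun x y => ?_⟩
    have : (f + g) y - (f + g) x = (f y - f x) + (g y - g x) := by
      simp only [Pi.add_apply]; ring
    rw [this, add_mul]
    exact (abs_add_le _ _).trans (add_le_add (hfK x y) (hgK x y))
  smul_mem' := by
    rintro c f ⟨hf, K, hK, hfK⟩
    refine ⟨by simp [hf], |c| * K, by positivity, fun x y => ?_⟩
    have : (c • f) y - (c • f) x = c * (f y - f x) := by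
      simp only [Pi.smul_apply, smul_eq_mul]; ring
    rw [this, abs_mul, mul_assoc]
    exact mul_le_mul_of_nonneg_left (hfK x y) (abs_nonneg c)

/-- The space `Lip₀(M)` of real-valued Lipschitz functions on `M` vanishing at `o`, normed by the
best Lipschitz constant. -/
def Lip0 (M : Type*) [MetricSpace M] (o : M) : Type _ := lipSubmodule M o

namespace Lip0

variable {o : M}

instance : AddCommGroup (Lip0 M o) := inferInstanceAs (AddCommGroup (lipSubmodule M o))

instance : Module ℝ (Lip0 M o) := inferInstanceAs (Module ℝ (lipSubmodule M o))

instance : CoeFun (Lip0 M o) (fun _ => M → ℝ) := ⟨fun f => f.1⟩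

instance : Norm (Lip0 M o) :=
  ⟨fun f => sInf {K : ℝ | 0 ≤ K ∧ ∀ x y, |f y - f x| ≤ K * dist x y}⟩

theorem norm_def (f : Lip0 M o) :
    ‖f‖ = sInf {K : ℝ | 0 ≤ K ∧ ∀ x y, |f y - f x| ≤ K * dist x y} := rfl

theorem apply_base (f : Lip0 M o) : f o = 0 := f.2.1

theorem add_apply (f g : Lip0 M o) (x : M) : (f + g) x = f x + g x := rfl

theorem smul_apply (c : ℝ) (f : Lip0 M o) (x : M) : (c • f) x = c * f x := rfl

theorem zero_apply (x : M) : (0 : Lip0 M o) x = 0 := rfl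

theorem ext' {f g : Lip0 M o} (h : ∀ x, f x = g x) : f = g := Subtype.ext (funext h)

theorem lip_nonneg (f : Lip0 M o) : 0 ≤ ‖f‖ := Real.sInf_nonneg fun _ h => h.1

theorem lip_le (f : Lip0 M o) {K : ℝ} (hK : 0 ≤ K) (h : ∀ x y, |f y - f x| ≤ K * dist x y) :
    ‖f‖ ≤ K :=
  csInf_le ⟨0, fun _ h => h.1⟩ ⟨hK, h⟩

theorem abs_sub_le (f : Lip0 M o) (x y : M) : |f y - f x| ≤ ‖f‖ * dist x y := by
  rcases eq_or_ne x y with rfl | hxy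
  · simp
  have hd : 0 < dist x y := dist_pos.2 hxy
  rw [← div_le_iff₀ hd]
  exact le_csInf f.2.2 fun K hK => (div_le_iff₀ hd).2 (hK.2 x y)

theorem core (M : Type*) [MetricSpace M] (o : M) : NormedSpace.Core ℝ (Lip0 M o) where
  norm_nonneg := lip_nonneg
  norm_smul := by
    have hle : ∀ (c : ℝ) (f : Lip0 M o), ‖c • f‖ ≤ ‖c‖ * ‖f‖ := by
      intro c f
      refine lip_le _ (mul_nonneg (norm_nonneg c) (lip_nonneg f)) fun x y => ?_
      rw [smul_apply, smul_apply, ← mul_sub, abs_mul, mul_assoc, Real.norm_eq_abs]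
      exact mul_le_mul_of_nonneg_left (abs_sub_le f x y) (abs_nonneg c)
    intro c f
    refine le_antisymm (hle c f) ?_
    rcases eq_or_ne c 0 with rfl | hc
    · rw [norm_zero, zero_mul]
      exact lip_nonneg _
    have h := hle c⁻¹ (c • f)
    rw [smul_smul, inv_mul_cancel₀ hc, one_smul, norm_inv] at h
    have hc' : 0 < ‖c‖ := norm_pos_iff.2 hc
    calc ‖c‖ * ‖f‖ ≤ ‖c‖ * (‖c‖⁻¹ * ‖c • f‖) := mul_le_mul_of_nonneg_left h hc'.le
      _ = ‖c • f‖ := by rw [← mul_assoc, mul_inv_cancel₀ hc'.ne', one_mul]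
  norm_triangle f g := by
    refine lip_le _ (add_nonneg (lip_nonneg f) (lip_nonneg g)) fun x y => ?_
    rw [add_apply, add_apply, add_sub_add_comm, add_mul]
    exact (abs_add_le _ _).trans (add_le_add (abs_sub_le f x y) (abs_sub_le g x y))
  norm_eq_zero_iff f := by
    constructor
    · intro h
      refine ext' fun x => ?_
      have := abs_sub_le f o x
      rw [h, zero_mul, apply_base, sub_zero] at this
      rw [zero_apply]
      exact abs_eq_zero.1 (le_antisymm this (abs_nonneg _))
    · rintro rfl
      exact le_antisymm (lip_le _ le_rfl fun x y => by simp [zero_apply]) (lip_nonneg _)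

instance : NormedAddCommGroup (Lip0 M o) := NormedAddCommGroup.ofCore (core M o)

instance : NormedSpace ℝ (Lip0 M o) := NormedSpace.ofCore (core M o)

/-- The evaluation functional `δ_x : f ↦ f x` on `Lip₀(M)`. -/
def eval (o x : M) : StrongDual ℝ (Lip0 M o) :=
  LinearMap.mkContinuous
    { toFun := fun f => f x
      map_add' := fun _ _ => rfl
      map_smul' := fun _ _ => rfl } (dist o x) fun f => by
    have := abs_sub_le f o x
    rw [apply_base, sub_zero, mul_comm] at this
    exact this

theorem eval_apply (x : M) (f : Lip0 M o) : eval o x f = f x := rfl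

end Lip0

/-- The Lipschitz-free space `𝓕(M)`: the closed linear span of the evaluation functionals in the
dual of `Lip₀(M)`. -/
def LipFree (M : Type*) [MetricSpace M] (o : M) : Submodule ℝ (StrongDual ℝ (Lip0 M o)) :=
  (Submodule.span ℝ (range (Lip0.eval o))).topologicalClosure

end LipschitzFree

end

/-! Write `C` for the closure of `A` and `o` for the root. The measure `μ` is built so that
`μ([o,a]) = d(o,a)` for every `a ∈ C`: the part of `[o,a]` in `C` is measured by length, and the
length of each gap of `C` on `[o,a]` is carried by an atom at the end of the gap farther from `o`
(`volume_add_tsum_gaps`, `treeMeasure_seg`). Two segments `[o,a]` and `[o,b]` separate at a point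
`c` of `[a,b]`, which is `o`, `a`, `b` or a branching point, hence lies in `C`. Therefore `‖1_[o,a]
- 1_[o,b]‖₁ ≤ d(a,c) + d(c,b) = d(a,b)` (`norm_indL1_seg_sub_le`), and `Φ(g)(a) = ⟨1_[o,a], g⟩`
defines a contraction from `L_∞(μ)` to `Lip₀(A)`.

Conversely, a Lipschitz `f` on `A` extends to `T` with the same constant and is differentiated
towards the root, relative to `C`: at the far end of a gap the derivative is the slope across the
gap, elsewhere it is almost everywhere the usual derivative. This density is bounded by `‖f‖`, and
the fundamental theorem of calculus along `[o,a]` returns `f(a)` (`integral_slopeLim_nextPt`,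
`integral_rootSlope`). So `Φ` is onto, with preimages of no larger norm.

The remaining point is that the indicators `1_[o,a]`, `a ∈ A`, span a dense subspace of `L₁(μ)`
(`eq_top_of_indL1_seg_mem_of_closure`). It gives injectivity of `Φ`, which is therefore an isometry.
It also identifies the predual: `h ↦ ⟨h, Φ⁻¹ ·⟩` embeds `L₁(μ)` isometrically in the dual of
`Lip₀(A)` and sends `1_[o,a]` to `δ_a`, so its range is exactly the closed span of the evaluations
(`range_predualMap`).

The measure `μ` need not be `σ`-finite, so duality of `L₁` and `L_∞` is not available in general.
Its substitute is that a measurable set which is null on every `[o,a]`, `a ∈ C`, is null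
(`treeMeasure_eq_zero_of_forall_seg`). -/

/-! ### Closed subsets of the real line and their gaps -/

namespace ClosedGaps

open Filter

noncomputable section

/-- The last point of `S` that is at most `t`. -/
def prevPt (S : Set ℝ) (t : ℝ) : ℝ := sSup (S ∩ Iic t)

/-- The first point of `S` that is at least `t`. -/
def nextPt (S : Set ℝ) (t : ℝ) : ℝ := sInf (S ∩ Ici t)

/-- The supremum of the points of `S` strictly below `t`. -/
def leftPt (S : Set ℝ) (t : ℝ) : ℝ := sSup (S ∩ Iio t)

/-- The points of `S` that are the right end of a gap of `S`. -/
def rightEnds (S : Set ℝ) : Set ℝ := {y | y ∈ S ∧ 0 < y ∧ leftPt S y < y}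

/-- The upper limit of the slopes of `H` between `t` and points of `S` to the left of `t`. -/
def slopeLim (S : Set ℝ) (H : ℝ → ℝ) (t : ℝ) : ℝ :=
  -- Truncation at `0` keeps the argument in the range where `prevPt` is a point of `S`. A `limsup`
  -- along a fixed sequence is defined at every `t` and is measurable in `t`, whether or not the
  -- slopes converge.
  limsup (fun n : ℕ => (H t - H (prevPt S (max 0 (t - 1 / (n + 1))))) /
    (t - prevPt S (max 0 (t - 1 / (n + 1))))) atTop

variable {S : Set ℝ} {d : ℝ}

theorem bddAbove_inter_Iic (t : ℝ) : BddAbove (S ∩ Iic t) := ⟨t, fun _ h => h.2⟩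

theorem bddAbove_inter_Iio (t : ℝ) : BddAbove (S ∩ Iio t) := ⟨t, fun _ h => le_of_lt h.2⟩

theorem bddBelow_inter_Ici (t : ℝ) : BddBelow (S ∩ Ici t) := ⟨t, fun _ h => h.2⟩

theorem prevPt_mem (hS : IsClosed S) (h0 : (0 : ℝ) ∈ S) {t : ℝ} (ht : 0 ≤ t) :
    prevPt S t ∈ S ∩ Iic t :=
  (hS.inter isClosed_Iic).csSup_mem ⟨0, h0, ht⟩ (bddAbove_inter_Iic t)

theorem le_prevPt {s t : ℝ} (hs : s ∈ S) (hst : s ≤ t) : s ≤ prevPt S t :=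
  le_csSup (bddAbove_inter_Iic t) ⟨hs, hst⟩

theorem prevPt_nonneg (h0 : (0 : ℝ) ∈ S) {t : ℝ} (ht : 0 ≤ t) : 0 ≤ prevPt S t :=
  le_prevPt h0 ht

theorem leftPt_mem (hS : IsClosed S) (h0 : (0 : ℝ) ∈ S) {t : ℝ} (ht : 0 < t) :
    leftPt S t ∈ S ∧ leftPt S t ≤ t := by
  have hne : (S ∩ Iio t).Nonempty := ⟨0, h0, ht⟩
  exact ⟨hS.closure_subset_iff.2 inter_subset_left (csSup_mem_closure hne (bddAbove_inter_Iio t)),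
    csSup_le hne fun _ h => le_of_lt h.2⟩

theorem le_leftPt {s t : ℝ} (hs : s ∈ S) (hst : s < t) : s ≤ leftPt S t :=
  le_csSup (bddAbove_inter_Iio t) ⟨hs, hst⟩

theorem nextPt_mem (hS : IsClosed S) (hd : d ∈ S) {t : ℝ} (ht : t ≤ d) :
    nextPt S t ∈ S ∩ Ici t :=
  (hS.inter isClosed_Ici).csInf_mem ⟨d, hd, ht⟩ (bddBelow_inter_Ici t)

theorem nextPt_le {s t : ℝ} (hs : s ∈ S) (hst : t ≤ s) : nextPt S t ≤ s :=
  csInf_le (bddBelow_inter_Ici t) ⟨hs, hst⟩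

theorem nextPt_of_mem (hS : IsClosed S) {t : ℝ} (ht : t ∈ S) : nextPt S t = t :=
  le_antisymm (nextPt_le ht le_rfl) (nextPt_mem hS ht le_rfl).2

theorem monotone_prevPt_max (h0 : (0 : ℝ) ∈ S) : Monotone fun t => prevPt S (max 0 t) := by
  intro s t hst
  exact csSup_le_csSup (bddAbove_inter_Iic _) ⟨0, h0, mem_Iic.2 (le_max_left _ _)⟩
    (inter_subset_inter_right _ (Iic_subset_Iic.2 (max_le_max le_rfl hst)))

theorem monotoneOn_nextPt (hd : d ∈ S) : MonotoneOn (nextPt S) (Iic d) := by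
  intro s _ t ht hst
  exact csInf_le_csInf (bddBelow_inter_Ici _) ⟨d, hd, ht⟩
    (inter_subset_inter_right _ (Ici_subset_Ici.2 hst))

theorem gap_disjoint {y t : ℝ} (ht : t ∈ Ioo (leftPt S y) y) : t ∉ S := fun h =>
  (le_leftPt h ht.2).not_gt ht.1

theorem nextPt_of_mem_gap (hS : IsClosed S) {y t : ℝ} (hy : y ∈ S)
    (ht : t ∈ Ioo (leftPt S y) y) : nextPt S t = y := by
  refine le_antisymm (nextPt_le hy ht.2.le) ?_
  have h := nextPt_mem hS hy ht.2.le
  by_contra! hlt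
  exact (le_leftPt h.1 hlt).not_gt (ht.1.trans_le h.2)

theorem pairwiseDisjoint_gaps :
    (rightEnds S).PairwiseDisjoint fun y => Ioo (leftPt S y) y := by
  have key : ∀ y ∈ rightEnds S, ∀ z ∈ rightEnds S, y < z →
      Disjoint (Ioo (leftPt S y) y) (Ioo (leftPt S z) z) := by
    intro y hy z _ hyz
    rw [Set.disjoint_left]
    intro t ht ht'
    exact (le_leftPt hy.1 hyz).not_gt (ht'.1.trans ht.2)
  intro y hy z hz hyz
  rcases lt_or_gt_of_ne hyz with h | h
  · exact key y hy z hz h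
  · exact (key z hz y hy h).symm

theorem countable_rightEnds : (rightEnds S).Countable :=
  pairwiseDisjoint_gaps.countable_of_isOpen (fun _ _ => isOpen_Ioo)
    fun _ hy => nonempty_Ioo.2 hy.2.2

/-- The gap around a point `t` outside `S` is the one that ends at `nextPt S t`: no point of `S`
lies between `t` and that end, so `leftPt` of the end falls strictly below `t`. -/
theorem diff_eq_iUnion_gaps (hS : IsClosed S) (h0 : (0 : ℝ) ∈ S) (hd : d ∈ S) :
    Icc 0 d \ S = ⋃ y ∈ rightEnds S ∩ Iic d, Ioo (leftPt S y) y := by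
  ext t
  simp only [mem_iUnion]
  constructor
  · rintro ⟨⟨ht0, htd⟩, htS⟩
    have h := nextPt_mem hS hd htd
    set y := nextPt S t with hy
    have hty : t < y := lt_of_le_of_ne h.2 fun h' => htS (h' ▸ h.1)
    have hy0 : 0 < y := ht0.trans_lt hty
    have hl := leftPt_mem hS h0 hy0
    have hlt : leftPt S y < t := by
      refine lt_of_le_of_ne (csSup_le ⟨0, h0, hy0⟩ ?_) fun h' => htS (h' ▸ hl.1)
      rintro s ⟨hs, hsy⟩
      by_contra! hts
      exact (nextPt_le hs hts.le).not_gt hsy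
    exact ⟨y, ⟨⟨h.1, hy0, hlt.trans hty⟩, nextPt_le hd htd⟩, hlt, hty⟩
  · rintro ⟨y, ⟨hy, hyd⟩, ht⟩
    refine ⟨⟨?_, ht.2.le.trans hyd⟩, gap_disjoint ht⟩
    exact (le_leftPt h0 hy.2.1).trans ht.1.le

/-- One-dimensional form of `μ([o,a]) = d(o,a)`. The gaps are disjoint intervals filling `[0,d] \
S`, and a point of `S` that ends no gap contributes zero to the sum. -/
theorem volume_add_tsum_gaps (hS : IsClosed S) (h0 : (0 : ℝ) ∈ S) (hd : d ∈ S)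
    (hsub : S ⊆ Icc 0 d) :
    volume S + ∑' y : S, (if (y : ℝ) = 0 then 0 else ENNReal.ofReal (y - leftPt S y))
      = ENNReal.ofReal d := by
  have hsum : ∑' y : S, (if (y : ℝ) = 0 then 0 else ENNReal.ofReal (y - leftPt S y))
      = volume (Icc 0 d \ S) := by
    have hY : rightEnds S ∩ Iic d = rightEnds S :=
      inter_eq_left.2 fun y hy => (hsub hy.1).2
    rw [diff_eq_iUnion_gaps hS h0 hd, hY, measure_biUnion countable_rightEnds
      pairwiseDisjoint_gaps fun _ _ => measurableSet_Ioo]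
    simp only [Real.volume_Ioo]
    set f : ℝ → ℝ≥0∞ := fun y => if y = 0 then 0 else ENNReal.ofReal (y - leftPt S y) with hf
    have h1 : ∑' y : rightEnds S, ENNReal.ofReal ((y : ℝ) - leftPt S y)
        = ∑' y : rightEnds S, f y := by
      refine tsum_congr fun y => ?_
      simp [hf, y.2.2.1.ne']
    rw [h1]
    change ∑' y : S, f y = _
    rw [tsum_subtype, tsum_subtype]
    refine tsum_congr fun y => ?_
    by_cases hy : y ∈ rightEnds S
    · rw [indicator_of_mem hy, indicator_of_mem hy.1]
    · rw [indicator_of_notMem hy]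
      by_cases hyS : y ∈ S
      · rw [indicator_of_mem hyS, hf]
        by_cases hy0 : y = 0
        · simp [hy0]
        · have hpos : 0 < y := lt_of_le_of_ne (hsub hyS).1 (Ne.symm hy0)
          have : ¬ leftPt S y < y := fun h => hy ⟨hyS, hpos, h⟩
          simp only [hy0, if_false, ENNReal.ofReal_eq_zero]
          linarith
      · rw [indicator_of_notMem hyS]
  have h := measure_sdiff_add_inter (μ := volume) (Icc 0 d) hS.measurableSet
  rw [inter_eq_right.2 hsub, Real.volume_Icc, sub_zero] at h
  rw [hsum, add_comm, h]

/-- Once `1/(n+1)` is smaller than the gap, `y - 1/(n+1)` lies inside it, so the sequence of slopes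
is eventually constant. -/
theorem slopeLim_of_mem_rightEnds (hS : IsClosed S) (h0 : (0 : ℝ) ∈ S) (H : ℝ → ℝ) {y : ℝ}
    (hy : y ∈ rightEnds S) : slopeLim S H y = (H y - H (leftPt S y)) / (y - leftPt S y) := by
  have hl := leftPt_mem hS h0 hy.2.1
  have hl0 : 0 ≤ leftPt S y := le_leftPt h0 hy.2.1
  have hev : ∀ᶠ n : ℕ in atTop, 1 / ((n : ℝ) + 1) < y - leftPt S y :=
    tendsto_one_div_add_atTop_nhds_zero_nat.eventually (gt_mem_nhds (sub_pos.2 hy.2.2))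
  have hpt : ∀ᶠ n : ℕ in atTop, prevPt S (max 0 (y - 1 / ((n : ℝ) + 1))) = leftPt S y := by
    filter_upwards [hev] with n hn
    have hn0 : 0 < 1 / ((n : ℝ) + 1) := Nat.one_div_pos_of_nat
    have hnn : 0 ≤ y - 1 / ((n : ℝ) + 1) := by linarith
    rw [max_eq_right hnn]
    have hm := prevPt_mem hS h0 hnn
    refine le_antisymm (le_leftPt hm.1 ?_) (le_prevPt hl.1 (by linarith))
    have := hm.2
    rw [mem_Iic] at this
    linarith
  refine Tendsto.limsup_eq (tendsto_const_nhds.congr' ?_)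
  filter_upwards [hpt] with n hn
  rw [hn]

/-- The hypothesis `t ≤ leftPt S t` says that `S` accumulates at `t` from the left, so the base
points of the slopes tend to `t`. -/
theorem slopeLim_of_differentiableAt (hS : IsClosed S) (h0 : (0 : ℝ) ∈ S) {H : ℝ → ℝ} {t : ℝ}
    (ht : 0 < t) (hl : t ≤ leftPt S t) (hH : DifferentiableAt ℝ H t) :
    slopeLim S H t = deriv H t := by
  have hslope := hasDerivAt_iff_tendsto_slope.1 hH.hasDerivAt
  have hlt : ∀ n : ℕ, prevPt S (max 0 (t - 1 / ((n : ℝ) + 1))) < t := by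
    intro n
    have hn0 : 0 < 1 / ((n : ℝ) + 1) := Nat.one_div_pos_of_nat
    exact ((prevPt_mem hS h0 (le_max_left _ _)).2 : _ ≤ _).trans_lt (max_lt ht (by linarith))
  have hlim : Tendsto (fun n : ℕ => prevPt S (max 0 (t - 1 / ((n : ℝ) + 1)))) atTop (𝓝[≠] t) := by
    refine tendsto_nhdsWithin_iff.2 ⟨?_, Eventually.of_forall fun n => (hlt n).ne⟩
    refine tendsto_order.2 ⟨fun a ha => ?_, fun a ha => Eventually.of_forall fun n =>
      (hlt n).trans ha⟩
    obtain ⟨s, hs, has⟩ := exists_lt_of_lt_csSup (⟨0, h0, ht⟩ : (S ∩ Iio t).Nonempty)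
      (ha.trans_le hl)
    have hev : ∀ᶠ n : ℕ in atTop, 1 / ((n : ℝ) + 1) < t - s :=
      tendsto_one_div_add_atTop_nhds_zero_nat.eventually (gt_mem_nhds (sub_pos.2 hs.2))
    filter_upwards [hev] with n hn
    exact has.trans_le (le_prevPt hs.1 ((by linarith : s ≤ _).trans (le_max_right _ _)))
  refine Tendsto.limsup_eq ((hslope.comp hlim).congr fun n => ?_)
  rw [Function.comp_apply, slope_def_field, ← neg_div_neg_eq, neg_sub, neg_sub]

theorem measurable_slopeLim (h0 : (0 : ℝ) ∈ S) {H : ℝ → ℝ} (hH : Continuous H) :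
    Measurable (slopeLim S H) := by
  refine Measurable.limsup fun n => ?_
  have h : Measurable fun t : ℝ => prevPt S (max 0 (t - 1 / ((n : ℝ) + 1))) :=
    (monotone_prevPt_max h0).measurable.comp (measurable_id.sub_const _)
  exact (hH.measurable.sub (hH.measurable.comp h)).div (measurable_id.sub h)

theorem abs_limsup_le {u : ℕ → ℝ} {K : ℝ} (hu : ∀ n, |u n| ≤ K) : |limsup u atTop| ≤ K := by
  have hb : IsBoundedUnder (· ≤ ·) atTop u := isBoundedUnder_of ⟨K, fun n => (abs_le.1 (hu n)).2⟩
  have hb' : IsBoundedUnder (· ≥ ·) atTop u :=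
    isBoundedUnder_of ⟨-K, fun n => (abs_le.1 (hu n)).1⟩
  refine abs_le.2 ⟨?_, ?_⟩
  · exact le_limsup_of_frequently_le (Frequently.of_forall fun n => (abs_le.1 (hu n)).1) hb
  · exact limsup_le_of_le hb'.isCoboundedUnder_le (Eventually.of_forall fun n => (abs_le.1 (hu n)).2)

theorem abs_slopeLim_le {H : ℝ → ℝ} {K : ℝ≥0} (hH : LipschitzWith K H) (t : ℝ) :
    |slopeLim S H t| ≤ K := by
  refine abs_limsup_le fun n => ?_
  rw [abs_div]
  -- A vanishing denominator, as at `t = 0`, gives quotient `0` and needs no separate case.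
  refine div_le_of_le_mul₀ (abs_nonneg _) K.2 ?_
  exact hH.dist_le_mul t _

theorem intervalIntegral_deriv_of_lipschitz {H : ℝ → ℝ} {K : ℝ≥0} (hH : LipschitzWith K H)
    (a b : ℝ) : IntervalIntegrable (deriv H) volume a b ∧ ∫ t in a..b, deriv H t = H b - H a := by
  have hac : AbsolutelyContinuousOnInterval H a b :=
    (hH.lipschitzOnWith (s := uIcc a b)).absolutelyContinuousOnInterval
  exact ⟨hac.intervalIntegrable_deriv, hac.integral_deriv_eq_sub⟩

theorem aemeasurable_nextPt (hd : d ∈ S) : AEMeasurable (nextPt S) (volume.restrict (Icc 0 d)) :=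
  aemeasurable_restrict_of_monotoneOn measurableSet_Icc
    ((monotoneOn_nextPt hd).mono Icc_subset_Iic_self)

theorem integrableOn_slopeLim_nextPt (h0 : (0 : ℝ) ∈ S) (hd : d ∈ S)
    {H : ℝ → ℝ} {K : ℝ≥0} (hH : LipschitzWith K H) :
    IntegrableOn (fun t => slopeLim S H (nextPt S t)) (Icc 0 d) := by
  have hm : AEMeasurable (fun t => slopeLim S H (nextPt S t)) (volume.restrict (Icc 0 d)) :=
    (measurable_slopeLim h0 hH.continuous).comp_aemeasurable (aemeasurable_nextPt hd)
  exact Integrable.of_bound hm.aestronglyMeasurable K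
    (Eventually.of_forall fun t => abs_slopeLim_le hH _)

/-- The integrand and `deriv H` have the same integral over `S` and over every gap. On `S` they
agree almost everywhere, the exceptions being `0`, the countably many right ends and the points
where `H` is not differentiable. On a gap the integrand is the constant slope between its ends,
which integrates to the increment of `H`. -/
theorem integral_slopeLim_nextPt (hS : IsClosed S) (h0 : (0 : ℝ) ∈ S) (hd : d ∈ S)
    (hsub : S ⊆ Icc 0 d) {H : ℝ → ℝ} {K : ℝ≥0} (hH : LipschitzWith K H) :
    ∫ t in Icc 0 d, slopeLim S H (nextPt S t) = H d - H 0 := by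
  have hd0 : 0 ≤ d := (hsub h0).2
  have hi := integrableOn_slopeLim_nextPt h0 hd hH
  have hi' : IntegrableOn (deriv H) (Icc 0 d) :=
    (intervalIntegrable_iff_integrableOn_Icc_of_le hd0).1
      (intervalIntegral_deriv_of_lipschitz hH 0 d).1
  have htot : ∫ t in Icc 0 d, deriv H t = H d - H 0 := by
    rw [integral_Icc_eq_integral_Ioc, ← intervalIntegral.integral_of_le hd0]
    exact (intervalIntegral_deriv_of_lipschitz hH 0 d).2
  rw [← htot, ← union_sdiff_cancel hsub]
  have hU : MeasurableSet (Icc 0 d \ S) := measurableSet_Icc.diff hS.measurableSet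
  rw [setIntegral_union disjoint_sdiff_right hU (hi.mono_set hsub) (hi.mono_set sdiff_subset),
    setIntegral_union disjoint_sdiff_right hU (hi'.mono_set hsub) (hi'.mono_set sdiff_subset)]
  congr 1
  · refine setIntegral_congr_ae hS.measurableSet ?_
    have hnull : ∀ᵐ t : ℝ, t ∉ rightEnds S ∪ {0} :=
      measure_eq_zero_iff_ae_notMem.1
        ((countable_rightEnds.union (countable_singleton 0)).measure_zero _)
    filter_upwards [hnull, hH.ae_differentiableAt_real] with t ht hdt htS
    have ht0 : 0 < t := lt_of_le_of_ne (hsub htS).1 fun h => ht (Or.inr h.symm)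
    rw [nextPt_of_mem hS htS]
    refine slopeLim_of_differentiableAt hS h0 ht0 ?_ hdt
    by_contra! hlt
    exact ht (Or.inl ⟨htS, ht0, hlt⟩)
  · have hcount : (rightEnds S ∩ Iic d).Countable := countable_rightEnds.mono inter_subset_left
    have hdisj : (rightEnds S ∩ Iic d).PairwiseDisjoint fun y => Ioo (leftPt S y) y :=
      pairwiseDisjoint_gaps.subset inter_subset_left
    have hi1 := hi.mono_set (sdiff_subset (s := Icc 0 d) (t := S))
    have hi2 := hi'.mono_set (sdiff_subset (s := Icc 0 d) (t := S))
    rw [diff_eq_iUnion_gaps hS h0 hd, biUnion_eq_iUnion] at hi1 hi2 ⊢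
    have : Countable ↥(rightEnds S ∩ Iic d) := hcount.to_subtype
    rw [integral_iUnion (fun _ => measurableSet_Ioo) (hdisj.subtype _ _) hi1,
      integral_iUnion (fun _ => measurableSet_Ioo) (hdisj.subtype _ _) hi2]
    refine tsum_congr fun y => ?_
    have hy : (y : ℝ) ∈ rightEnds S := y.2.1
    have hle := hy.2.2.le
    rw [setIntegral_congr_fun (g := fun _ => (H y - H (leftPt S y)) / (y - leftPt S y))
      measurableSet_Ioo fun t ht => by
        simp only [nextPt_of_mem_gap hS hy.1 ht, slopeLim_of_mem_rightEnds hS h0 H hy]]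
    rw [← integral_Ioc_eq_integral_Ioo, ← integral_Ioc_eq_integral_Ioo,
      ← intervalIntegral.integral_of_le hle, ← intervalIntegral.integral_of_le hle,
      (intervalIntegral_deriv_of_lipschitz hH _ _).2, intervalIntegral.integral_const, smul_eq_mul,
      mul_div_cancel₀ _ (sub_pos.2 hy.2.2).ne']

/-- On `[0,d]`, `nextPt` and `prevPt` are adjoint: `nextPt S s ≤ t` exactly when `s ≤ prevPt S t`.
-/
theorem volume_nextPt_preimage (hS : IsClosed S) (h0 : (0 : ℝ) ∈ S) (hd : d ∈ S)
    {t : ℝ} (ht : t ∈ Icc 0 d) :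
    volume (nextPt S ⁻¹' Iic t ∩ Icc 0 d) = ENNReal.ofReal (prevPt S t) := by
  have hm := prevPt_mem hS h0 ht.1
  have : nextPt S ⁻¹' Iic t ∩ Icc 0 d = Icc 0 (prevPt S t) := by
    ext s
    constructor
    · rintro ⟨hs, hs0, hsd⟩
      have h := nextPt_mem hS hd hsd
      exact ⟨hs0, (h.2 : _ ≤ _).trans (le_prevPt h.1 hs)⟩
    · rintro ⟨hs0, hs⟩
      exact ⟨(nextPt_le hm.1 hs).trans hm.2, hs0, hs.trans ((hm.2 : _ ≤ _).trans ht.2)⟩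
  rw [this, Real.volume_Icc, sub_zero]

end

end ClosedGaps

/-! ### Geometry of segments in an `ℝ`-tree -/

namespace RTree

noncomputable section

variable {T : Type*} [MetricSpace T] [RTree T]

/-- The geodesic from `x` to `y`, extended to `ℝ` by constants. -/
def path (x y : T) (t : ℝ) : T := geod x y (projIcc 0 (dist x y) dist_nonneg t)

theorem path_of_mem {x y : T} {t : ℝ} (ht : t ∈ Icc 0 (dist x y)) :
    path x y t = geod x y ⟨t, ht⟩ := by
  rw [path, projIcc_of_mem _ ht]

theorem path_mem_seg (x y : T) (t : ℝ) : path x y t ∈ seg x y := mem_range_self _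

theorem path_zero (x y : T) : path x y 0 = x := by
  rw [path_of_mem (left_mem_Icc.2 dist_nonneg), geod_left]

theorem path_dist (x y : T) : path x y (dist x y) = y := by
  rw [path_of_mem (right_mem_Icc.2 dist_nonneg), geod_right]

theorem dist_path {x y : T} {s t : ℝ} (hs : s ∈ Icc 0 (dist x y)) (ht : t ∈ Icc 0 (dist x y)) :
    dist (path x y s) (path x y t) = |s - t| := by
  rw [path_of_mem hs, path_of_mem ht, (geod_isometry x y).dist_eq, Subtype.dist_eq, Real.dist_eq]

theorem lipschitzWith_path (x y : T) : LipschitzWith 1 (path x y) := by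
  have := (geod_isometry x y).lipschitz.comp (LipschitzWith.projIcc (dist_nonneg (x := x) (y := y)))
  rwa [one_mul] at this

theorem dist_left_path {x y : T} {t : ℝ} (ht : t ∈ Icc 0 (dist x y)) :
    dist x (path x y t) = t := by
  have := dist_path (left_mem_Icc.2 dist_nonneg) ht
  rwa [path_zero, zero_sub, abs_neg, abs_of_nonneg ht.1] at this

theorem dist_path_right {x y : T} {t : ℝ} (ht : t ∈ Icc 0 (dist x y)) :
    dist (path x y t) y = dist x y - t := by
  have := dist_path ht (right_mem_Icc.2 dist_nonneg)
  rwa [path_dist, abs_sub_comm, abs_of_nonneg (sub_nonneg.2 ht.2)] at this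

theorem mem_params_iff {x y : T} {B : Set T} {t : ℝ} :
    t ∈ params x y B ↔ t ∈ Icc 0 (dist x y) ∧ path x y t ∈ B := by
  constructor
  · intro h
    have ht := params_subset _ _ _ h
    exact ⟨ht, by rw [path_of_mem ht]; exact (mem_params ht).1 h⟩
  · rintro ⟨ht, h⟩
    rw [path_of_mem ht] at h
    exact (mem_params ht).2 h

theorem dist_add_dist_of_mem_seg {x y z : T} (h : z ∈ seg x y) :
    dist x z + dist z y = dist x y := by
  obtain ⟨⟨t, ht⟩, rfl⟩ := h
  rw [← path_of_mem ht, dist_left_path ht, dist_path_right ht]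
  ring

theorem eq_path_of_mem_seg {x y z : T} (h : z ∈ seg x y) : z = path x y (dist x z) := by
  obtain ⟨⟨t, ht⟩, rfl⟩ := h
  rw [← path_of_mem ht, dist_left_path ht]

theorem dist_mem_Icc_of_mem_seg {x y z : T} (h : z ∈ seg x y) :
    dist x z ∈ Icc 0 (dist x y) :=
  ⟨dist_nonneg, by linarith [dist_add_dist_of_mem_seg h, dist_nonneg (x := z) (y := y)]⟩

/-- When the triangle inequality is an equality at `z`, the geodesics from `x` to `z` and from `z`
to `y` concatenate to an isometry, which is the geodesic from `x` to `y` by uniqueness. -/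
theorem mem_seg_of_dist_add {x y z : T} (h : dist x z + dist z y = dist x y) : z ∈ seg x y := by
  have hxz : 0 ≤ dist x z := dist_nonneg
  have hzy : 0 ≤ dist z y := dist_nonneg
  set ψ : Icc (0 : ℝ) (dist x y) → T := fun t =>
    if t.1 ≤ dist x z then path x z t else path z y (t - dist x z) with hψ
  have h1 : ∀ t : Icc (0 : ℝ) (dist x y), t.1 ≤ dist x z → t.1 ∈ Icc 0 (dist x z) :=
    fun t ht => ⟨t.2.1, ht⟩
  have h2 : ∀ t : Icc (0 : ℝ) (dist x y), ¬ t.1 ≤ dist x z → t.1 - dist x z ∈ Icc 0 (dist z y) :=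
    fun t ht => ⟨by linarith, by linarith [t.2.2]⟩
  have hmix : ∀ s t : Icc (0 : ℝ) (dist x y), s.1 ≤ dist x z → ¬ t.1 ≤ dist x z →
      dist (path x z s) (path z y (t - dist x z)) = t - s := by
    intro s t hs ht
    have a1 := dist_left_path (h1 s hs)
    have a2 := dist_path_right (h1 s hs)
    have a3 := dist_left_path (h2 t ht)
    have a4 := dist_path_right (h2 t ht)
    refine le_antisymm ?_ ?_
    · linarith [dist_triangle (path x z s) z (path z y (t - dist x z))]
    -- A shorter connection between the two halves would give a path from `x` to `y` shorter than
    -- `d(x,y)`.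
    · linarith [dist_triangle4 x (path x z s) (path z y (t - dist x z)) y]
  have hiso : Isometry ψ := by
    refine Isometry.of_dist_eq fun s t => ?_
    rw [Subtype.dist_eq, Real.dist_eq]
    by_cases hs : s.1 ≤ dist x z <;> by_cases ht : t.1 ≤ dist x z <;>
      simp only [hψ, hs, ht, if_true, if_false]
    · exact dist_path (h1 s hs) (h1 t ht)
    · rw [hmix s t hs ht, abs_sub_comm, abs_of_nonneg]
      linarith
    · rw [dist_comm, hmix t s ht hs, abs_of_nonneg]
      linarith
    · rw [dist_path (h2 s hs) (h2 t ht)]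
      congr 1
      ring
  have h0 : ψ ⟨0, left_mem_Icc.2 dist_nonneg⟩ = x := by
    simp only [hψ, dist_nonneg, if_true, path_zero]
  have hd : ψ ⟨dist x y, right_mem_Icc.2 dist_nonneg⟩ = y := by
    by_cases hle : dist x y ≤ dist x z
    · have : z = y := dist_eq_zero.1 (by linarith)
      subst this
      simp only [hψ, le_refl, if_true, path_dist]
    · simp only [hψ, hle, if_false]
      rw [show dist x y - dist x z = dist z y by linarith, path_dist]
  rw [seg, ← geod_unique x y ψ hiso h0 hd]
  refine ⟨⟨dist x z, hxz, by linarith⟩, ?_⟩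
  simp only [hψ, le_refl, if_true, path_dist]

theorem mem_seg_iff {x y z : T} : z ∈ seg x y ↔ dist x z + dist z y = dist x y :=
  ⟨dist_add_dist_of_mem_seg, mem_seg_of_dist_add⟩

theorem right_mem_seg (x y : T) : y ∈ seg x y := by simp [mem_seg_iff]

theorem seg_comm (x y : T) : seg x y = seg y x := by
  ext z
  rw [mem_seg_iff, mem_seg_iff, dist_comm x z, dist_comm z y, dist_comm x y, add_comm]

theorem isCompact_seg (x y : T) : IsCompact (seg x y) :=
  isCompact_range (geod_isometry x y).continuous

theorem isClosed_seg (x y : T) : IsClosed (seg x y) := (isCompact_seg x y).isClosed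

theorem seg_self (x : T) : seg x x = {x} := by
  ext z
  rw [mem_seg_iff, mem_singleton_iff]
  constructor
  · intro h
    rw [dist_self, dist_comm z x] at h
    exact (dist_eq_zero.1 (by linarith)).symm
  · rintro rfl
    simp

theorem mem_seg_left_iff {o a z w : T} (hz : z ∈ seg o a) :
    w ∈ seg o z ↔ w ∈ seg o a ∧ dist o w ≤ dist o z := by
  have hz' := dist_add_dist_of_mem_seg hz
  constructor
  · intro hw
    have hw' := dist_add_dist_of_mem_seg hw
    have h1 := dist_triangle w z a
    have h2 := dist_triangle o w a
    exact ⟨mem_seg_of_dist_add (by linarith), by linarith [dist_nonneg (x := w) (y := z)]⟩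
  · rintro ⟨hw, hle⟩
    refine mem_seg_of_dist_add ?_
    have h := dist_path (dist_mem_Icc_of_mem_seg hw) (dist_mem_Icc_of_mem_seg hz)
    rw [← eq_path_of_mem_seg hw, ← eq_path_of_mem_seg hz, abs_sub_comm,
      abs_of_nonneg (sub_nonneg.2 hle)] at h
    rw [h]
    ring

theorem seg_subset_seg_left {o a z : T} (hz : z ∈ seg o a) : seg o z ⊆ seg o a :=
  fun _ hw => ((mem_seg_left_iff hz).1 hw).1

theorem path_eq_path_of_mem_seg {o a z : T} (hz : z ∈ seg o a) {s : ℝ}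
    (hs : s ∈ Icc 0 (dist o z)) : path o z s = path o a s := by
  have hs' : s ∈ Icc 0 (dist o a) := ⟨hs.1, hs.2.trans (dist_mem_Icc_of_mem_seg hz).2⟩
  have h : path o a s ∈ seg o z :=
    (mem_seg_left_iff hz).2 ⟨path_mem_seg _ _ _, by rw [dist_left_path hs']; exact hs.2⟩
  rw [eq_path_of_mem_seg h, dist_left_path hs']

theorem params_of_mem_seg {o a z : T} (hz : z ∈ seg o a) (B : Set T) :
    params o z B = params o a B ∩ Iic (dist o z) := by
  have hle := (dist_mem_Icc_of_mem_seg hz).2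
  ext s
  rw [mem_inter_iff, mem_params_iff, mem_params_iff]
  constructor
  · rintro ⟨hs, h⟩
    rw [path_eq_path_of_mem_seg hz hs] at h
    exact ⟨⟨⟨hs.1, hs.2.trans hle⟩, h⟩, hs.2⟩
  · rintro ⟨⟨hs, h⟩, hs'⟩
    refine ⟨⟨hs.1, hs'⟩, ?_⟩
    rwa [path_eq_path_of_mem_seg hz ⟨hs.1, hs'⟩]

theorem seg_subset_union {x y c : T} (hc : c ∈ seg x y) : seg x y ⊆ seg x c ∪ seg c y := by
  intro z hz
  rcases le_total (dist x z) (dist x c) with h | h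
  · exact Or.inl ((mem_seg_left_iff hc).2 ⟨hz, h⟩)
  · right
    rw [seg_comm] at hz hc ⊢
    refine (mem_seg_left_iff hc).2 ⟨hz, ?_⟩
    have h1 := dist_add_dist_of_mem_seg hz
    have h2 := dist_add_dist_of_mem_seg hc
    rw [dist_comm z x, dist_comm y x] at h1
    rw [dist_comm c x, dist_comm y x] at h2
    linarith

/-- The concatenation of `[a,c]` and `[c,b]` is an injective path, so its range is `[a,b]`. The
second axiom of `ℝ`-trees enters only here. -/
theorem mem_seg_of_inter_eq_singleton {a b c : T} (h : seg c a ∩ seg c b ⊆ {c}) : c ∈ seg a b := by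
  -- For `c ≠ a` the total length `D` is positive, and `t ↦ t * D` is an injective reparametrisation
  -- of `[0,1]`.
  rcases eq_or_ne c a with rfl | hca
  · exact left_mem_seg _ _
  set p := dist a c with hp
  set D := p + dist c b with hD
  have hp0 : 0 < p := dist_pos.2 hca.symm
  have hD0 : 0 < D := add_pos_of_pos_of_nonneg hp0 dist_nonneg
  set ψ : Icc (0 : ℝ) 1 → T := fun t =>
    if t.1 * D ≤ p then path a c (t.1 * D) else path c b (t.1 * D - p) with hψ
  have hcont : Continuous ψ := by
    have h1 : Continuous fun t : Icc (0 : ℝ) 1 => path a c (t.1 * D) :=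
      (lipschitzWith_path a c).continuous.comp (continuous_subtype_val.mul continuous_const)
    have h2 : Continuous fun t : Icc (0 : ℝ) 1 => path c b (t.1 * D - p) :=
      (lipschitzWith_path c b).continuous.comp
        ((continuous_subtype_val.mul continuous_const).sub continuous_const)
    refine Continuous.if_le h1 h2 (continuous_subtype_val.mul continuous_const) continuous_const ?_
    intro t ht
    rw [ht, sub_self, path_zero, hp, path_dist]
  have hm1 : ∀ t : Icc (0 : ℝ) 1, t.1 * D ≤ p → t.1 * D ∈ Icc 0 (dist a c) :=
    fun t ht => ⟨mul_nonneg t.2.1 hD0.le, ht⟩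
  have hm2 : ∀ t : Icc (0 : ℝ) 1, ¬ t.1 * D ≤ p → t.1 * D - p ∈ Icc 0 (dist c b) := by
    intro t ht
    have : t.1 * D ≤ 1 * D := mul_le_mul_of_nonneg_right t.2.2 hD0.le
    exact ⟨by linarith, by linarith⟩
  have hmix : ∀ s t : Icc (0 : ℝ) 1, s.1 * D ≤ p → ¬ t.1 * D ≤ p →
      path a c (s.1 * D) ≠ path c b (t.1 * D - p) := by
    intro s t hs ht heq
    have hc : path c b (t.1 * D - p) = c := h ⟨by
      rw [seg_comm, ← heq]; exact path_mem_seg _ _ _, path_mem_seg _ _ _⟩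
    have := dist_left_path (hm2 t ht)
    rw [hc, dist_self] at this
    exact ht (by linarith)
  have hinj : Function.Injective ψ := by
    intro s t hst
    have key : s.1 * D = t.1 * D → s = t := fun h =>
      Subtype.ext (mul_right_cancel₀ hD0.ne' h)
    by_cases hs : s.1 * D ≤ p <;> by_cases ht : t.1 * D ≤ p <;>
      simp only [hψ, hs, ht, if_true, if_false] at hst
    · have := dist_path (hm1 s hs) (hm1 t ht)
      rw [hst, dist_self, eq_comm, abs_eq_zero, sub_eq_zero] at this
      exact key this
    · exact (hmix s t hs ht hst).elim
    · exact (hmix t s ht hs hst.symm).elim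
    · have := dist_path (hm2 s hs) (hm2 t ht)
      rw [hst, dist_self, eq_comm, abs_eq_zero, sub_eq_zero] at this
      exact key (by linarith)
  have h0 : ψ 0 = a := by
    simp [hψ, hp0.le, path_zero]
  have h1 : ψ 1 = b := by
    by_cases hle : D ≤ p
    · have : c = b := dist_le_zero.1 (by linarith)
      subst this
      have hDp : D = dist a c := by simp [hD, hp]
      simp only [hψ, Icc.coe_one, one_mul, if_pos hle]
      rw [hDp, path_dist]
    · simp only [hψ, Icc.coe_one, one_mul, hle, if_false]
      rw [show D - p = dist c b by rw [hD]; ring, path_dist]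
  have hr := range_eq_of_injective ψ hcont hinj (geod (ψ 0) (ψ 1)) (geod_isometry _ _)
    (geod_left _ _) (geod_right _ _)
  have hc : c ∈ range ψ := by
    refine ⟨⟨p / D, by positivity, (div_le_one hD0).2 (by linarith [dist_nonneg (x := c) (y := b)])⟩, ?_⟩
    simp only [hψ, div_mul_cancel₀ _ hD0.ne', le_refl, if_true, hp, path_dist]
  rw [hr, h0, h1] at hc
  exact hc

/-- Take `c` to be the point of `[o,a] ∩ [o,b]` farthest from `o`. A point common to `[c,a]` and
`[c,b]` lies in the same intersection, at distance `d(o,c) + d(c,z)` from `o`, so it equals `c`. -/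
theorem exists_median (o a b : T) : ∃ c, c ∈ seg o a ∧ c ∈ seg o b ∧ c ∈ seg a b := by
  obtain ⟨c, ⟨hca, hcb⟩, hmax⟩ := ((isCompact_seg o a).inter (isCompact_seg o b)).exists_isMaxOn
    ⟨o, left_mem_seg _ _, left_mem_seg _ _⟩ (f := fun z => dist o z)
    (continuous_const.dist continuous_id).continuousOn
  refine ⟨c, hca, hcb, mem_seg_of_inter_eq_singleton ?_⟩
  rintro z ⟨hza, hzb⟩
  have key : ∀ e, c ∈ seg o e → z ∈ seg c e → z ∈ seg o e ∧ dist o z = dist o c + dist c z := by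
    intro e hc hz
    have h1 := dist_add_dist_of_mem_seg hc
    have h2 := dist_add_dist_of_mem_seg hz
    have h3 := dist_triangle o z e
    have h4 := dist_triangle o c z
    exact ⟨mem_seg_of_dist_add (by linarith), by linarith⟩
  have hz := hmax (show z ∈ seg o a ∩ seg o b from ⟨(key a hca hza).1, (key b hcb hzb).1⟩)
  have hz' := (key a hca hza).2
  simp only [mem_ofPred_eq] at hz
  exact (dist_le_zero.1 (by linarith : dist c z ≤ 0)).symm

theorem seg_subset_seg_union (o a b : T) : seg a b ⊆ seg o a ∪ seg o b := by
  obtain ⟨c, ha, hb, hab⟩ := exists_median o a b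
  refine (seg_subset_union hab).trans (union_subset_union ?_ ?_)
  · rw [seg_comm a c, seg_comm c a, seg_comm o a]
    exact seg_subset_seg_left (by rwa [seg_comm])
  · rw [seg_comm c b, seg_comm o b]
    exact seg_subset_seg_left (by rwa [seg_comm])

/-- Points joined by a segment through `c` lie in distinct components of the complement of `c`. -/
theorem connectedComponent_ne {c : T} (x y : ({c}ᶜ : Set T)) (h : c ∈ seg (x : T) y) :
    (ConnectedComponents.mk x) ≠ ConnectedComponents.mk y := by
  -- The points reached from `x` without crossing `c` form a clopen set: points close to `z` are
  -- joined to `z` inside a ball that misses `c`, and one side of a triangle is covered by the other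
  -- two. Hence `U` contains the component of `x`, but not `y`.
  set U : Set ({c}ᶜ : Set T) := {z | c ∉ seg (x : T) z} with hU
  have hnear : ∀ z : ({c}ᶜ : Set T), ∀ᶠ w : ({c}ᶜ : Set T) in 𝓝 z, c ∉ seg (z : T) w := by
    intro z
    have hz : 0 < dist (z : T) c := dist_pos.2 z.2
    filter_upwards [Metric.ball_mem_nhds z hz] with w hw hc
    rw [Metric.mem_ball, Subtype.dist_eq, dist_comm] at hw
    exact (dist_mem_Icc_of_mem_seg hc).2.not_gt hw
  have hopen : IsOpen U := by
    refine isOpen_iff_mem_nhds.2 fun z hz => ?_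
    filter_upwards [hnear z] with w hw hc
    rcases seg_subset_seg_union (z : T) _ _ hc with h | h
    · exact hz (by rwa [seg_comm])
    · exact hw h
  have hclosed : IsClosed U := by
    refine isOpen_compl_iff.1 (isOpen_iff_mem_nhds.2 fun z hz => ?_)
    filter_upwards [hnear z] with w hw hc
    refine hz fun hcz => ?_
    rcases seg_subset_seg_union (w : T) _ _ hcz with h | h
    · exact hc (by rwa [seg_comm])
    · exact hw (by rwa [seg_comm])
  intro heq
  have hx : x ∈ U := by
    simp only [hU, mem_ofPred_eq, seg_self]
    exact fun h => x.2 (mem_singleton_iff.1 h).symm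
  have hmem : y ∈ connectedComponent x := by
    rw [ConnectedComponents.coe_eq_coe.1 heq]
    exact mem_connectedComponent
  exact (IsClopen.connectedComponent_subset ⟨hclosed, hopen⟩ hx hmem) h

theorem mem_branchingPoints {o a b c : T} (ha : c ∈ seg o a) (hb : c ∈ seg o b)
    (hab : c ∈ seg a b) (hco : c ≠ o) (hca : c ≠ a) (hcb : c ≠ b) : c ∈ branchingPoints T := by
  have h1 := connectedComponent_ne (c := c) ⟨o, hco.symm⟩ ⟨a, hca.symm⟩ ha
  have h2 := connectedComponent_ne (c := c) ⟨o, hco.symm⟩ ⟨b, hcb.symm⟩ hb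
  have h3 := connectedComponent_ne (c := c) ⟨a, hca.symm⟩ ⟨b, hcb.symm⟩ hab
  classical
  let F : Finset (ConnectedComponents ({c}ᶜ : Set T)) :=
    {ConnectedComponents.mk ⟨o, hco.symm⟩, ConnectedComponents.mk ⟨a, hca.symm⟩,
      ConnectedComponents.mk ⟨b, hcb.symm⟩}
  have hF : F.card = 3 := Finset.card_eq_three.2 ⟨_, _, _, h1, h2, h3, rfl⟩
  have hle := Set.encard_le_encard (subset_univ (F : Set (ConnectedComponents ({c}ᶜ : Set T))))
  rw [Set.encard_coe_eq_coe_finsetCard, hF, Set.encard_univ] at hle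
  exact hle

/-- Meets of points of a set that contains the root and the branching points stay in that set. -/
theorem exists_meet {C : Set T} (hC : branchingPoints T ⊆ C) {o a b : T} (ho : o ∈ C) (ha : a ∈ C)
    (hb : b ∈ C) : ∃ c ∈ C, c ∈ seg o a ∧ c ∈ seg o b ∧ c ∈ seg a b := by
  obtain ⟨c, hca, hcb, hcab⟩ := exists_median o a b
  refine ⟨c, ?_, hca, hcb, hcab⟩
  by_cases h1 : c = o
  · exact h1 ▸ ho
  by_cases h2 : c = a
  · exact h2 ▸ ha
  by_cases h3 : c = b
  · exact h3 ▸ hb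
  exact hC (mem_branchingPoints hca hcb hcab h1 h2 h3)

/-! ### Measurability -/

instance : OpensMeasurableSpace T where
  borel_le := by
    rw [borel_eq_generateFrom_isClosed]
    exact MeasurableSpace.generateFrom_le fun B hB x y =>
      (params_isClosed x y hB).measurableSet.nullMeasurableSet

theorem measurableSet_seg (x y : T) : MeasurableSet (seg x y) := (isClosed_seg x y).measurableSet

/-- It suffices to test measurability on segments from the root. -/
theorem measurableSet_of_root (o : T) {B : Set T}
    (h : ∀ a, NullMeasurableSet (params o a B) volume) : MeasurableSet B := by
  intro x y
  -- The segment `[x,y]` runs back along `[o,x]` to `c` and then forward along `[o,y]`, so its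
  -- parameters are a reflection and a translation of those of the two segments from the root.
  obtain ⟨c, hx, hy, hxy⟩ := exists_median o x y
  have e1 := dist_add_dist_of_mem_seg hx
  have e2 := dist_add_dist_of_mem_seg hy
  have e3 := dist_add_dist_of_mem_seg hxy
  have n1 := dist_nonneg (x := o) (y := c)
  have n2 := dist_nonneg (x := x) (y := c)
  have n3 := dist_nonneg (x := c) (y := y)
  rw [dist_comm c x] at e1
  have hcxo : c ∈ seg x o := by rwa [seg_comm]
  have p1 : ∀ t ∈ Icc 0 (dist x c), path x y t = path o x (dist o x - t) := by
    intro t ht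
    have ht' : t ∈ Icc 0 (dist x o) := ⟨ht.1, by rw [dist_comm]; linarith [ht.2]⟩
    have hz : path x o t ∈ seg o x := by rw [seg_comm]; exact path_mem_seg _ _ _
    rw [← path_eq_path_of_mem_seg hxy ht, path_eq_path_of_mem_seg hcxo ht, eq_path_of_mem_seg hz,
      dist_comm, dist_path_right ht', dist_comm o x]
  have p2 : ∀ t ∈ Icc (dist x c) (dist x y),
      path x y t = path o y (t + (dist o c - dist x c)) := by
    intro t ht
    have ht0 : t ∈ Icc 0 (dist x y) := ⟨n2.trans ht.1, ht.2⟩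
    have hz : path x y t ∈ seg c y := by
      rw [seg_comm]
      refine (mem_seg_left_iff (by rwa [seg_comm])).2 ⟨by rw [seg_comm]; exact path_mem_seg _ _ _, ?_⟩
      rw [dist_comm, dist_path_right ht0, dist_comm y c]
      linarith [ht.1]
    have e4 := dist_add_dist_of_mem_seg hz
    have e5 := dist_path_right ht0
    have h1 := dist_triangle o c (path x y t)
    have h2 := dist_triangle o (path x y t) y
    have hoz : dist o (path x y t) = t + (dist o c - dist x c) := by linarith
    have hz' : path x y t ∈ seg o y := mem_seg_of_dist_add (by linarith)
    rw [← hoz]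
    exact eq_path_of_mem_seg hz'
  have hset : params x y B =
      (Icc 0 (dist x c) ∩ (fun t => dist o x - t) ⁻¹' params o x B) ∪
      (Icc (dist x c) (dist x y) ∩ (fun t => t + (dist o c - dist x c)) ⁻¹' params o y B) := by
    ext t
    simp only [mem_union, mem_inter_iff, mem_preimage, mem_params_iff]
    constructor
    · rintro ⟨ht, hB⟩
      rcases le_total t (dist x c) with hle | hle
      · rw [p1 t ⟨ht.1, hle⟩] at hB
        exact Or.inl ⟨⟨ht.1, hle⟩, ⟨by linarith, by linarith [ht.1]⟩, hB⟩
      · rw [p2 t ⟨hle, ht.2⟩] at hB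
        exact Or.inr ⟨⟨hle, ht.2⟩, ⟨by linarith, by linarith [ht.2]⟩, hB⟩
    · rintro (⟨ht, -, hB⟩ | ⟨ht, -, hB⟩)
      · rw [← p1 t ht] at hB
        exact ⟨⟨ht.1, by linarith [ht.2]⟩, hB⟩
      · rw [← p2 t ht] at hB
        exact ⟨⟨n2.trans ht.1, ht.2⟩, hB⟩
  rw [hset]
  refine (measurableSet_Icc.nullMeasurableSet.inter ?_).union
    (measurableSet_Icc.nullMeasurableSet.inter ?_)
  · exact (h x).preimage (Measure.measurePreserving_sub_left volume _).quasiMeasurePreserving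
  · exact (h y).preimage (measurePreserving_add_right volume _).quasiMeasurePreserving

end

end RTree

/-! ### The measure of segments -/

namespace RTree

open ClosedGaps

noncomputable section

variable {T : Type*} [MetricSpace T] [RTree T]

theorem volume_image_le_of_lipschitzWith_one {h : ℝ → ℝ} (hh : LipschitzWith 1 h) (s : Set ℝ) :
    volume (h '' s) ≤ volume s := by
  have := hh.hausdorffMeasure_image_le zero_le_one s
  rwa [hausdorffMeasure_real, ENNReal.coe_one, ENNReal.one_rpow, one_mul] at this

/-- No disjoint family of segments can measure more of `B` than `[o,a]` does: the traces of the
family on `B` have disjoint parameter sets along `[o,a]`, and passing from those parameters to the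
ones on the other segment does not increase Lebesgue measure. -/
theorem length_eq_segLength {o a : T} {B : Set T} (hB : MeasurableSet B) (hsub : B ⊆ seg o a) :
    length B = segLength o a B := by
  classical
  refine le_antisymm (iSup₂_le fun R hR => ?_) ?_
  · have h1 : ∀ p ∈ R, segLength p.1 p.2 B ≤ volume (params o a (B ∩ seg p.1 p.2)) := by
      intro p _
      -- On its own segment a point has as parameter its distance to `p.1`, a 1-Lipschitz function
      -- of the parameter along `[o,a]`.
      have hlip : LipschitzWith 1 fun s => dist p.1 (path o a s) := by
        have := (LipschitzWith.dist_right p.1).comp (lipschitzWith_path o a)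
        rwa [one_mul] at this
      refine le_trans (measure_mono ?_) (volume_image_le_of_lipschitzWith_one hlip _)
      intro t ht
      obtain ⟨ht, hBt⟩ := mem_params_iff.1 ht
      have hseg := hsub hBt
      refine ⟨dist o (path p.1 p.2 t), mem_params_iff.2 ⟨dist_mem_Icc_of_mem_seg hseg, ?_⟩, ?_⟩
      · rw [← eq_path_of_mem_seg hseg]
        exact ⟨hBt, path_mem_seg _ _ _⟩
      · simp only
        rw [← eq_path_of_mem_seg hseg, dist_left_path ht]
    refine (Finset.sum_le_sum h1).trans ?_
    rw [← measure_biUnion_finset₀]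
    · refine measure_mono (iUnion₂_subset fun p _ => params_mono _ _ inter_subset_left)
    · intro p hp q hq hpq
      exact (params_disjoint o a ((hR hp hq hpq).mono inter_subset_right
        inter_subset_right)).aedisjoint
    · exact fun p _ => (hB.inter (measurableSet_seg _ _)) o a
  · refine le_iSup₂_of_le {(o, a)} (by simp [IsDisjointFamily]) ?_
    simp

theorem params_inter_seg (o a : T) (B : Set T) : params o a (B ∩ seg o a) = params o a B := by
  ext t
  simp [mem_params_iff, path_mem_seg]

theorem treeMeasure_apply (o : T) (C : Set T) (hC : MeasurableSet C) {B : Set T}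
    (hB : MeasurableSet B) : treeMeasure o C B = length (B ∩ C) +
      ∑' c : T, (C ∩ B).indicator (fun c => ENNReal.ofReal (rootGap o C c)) c := by
  rw [treeMeasure, Measure.add_apply, Measure.restrict_apply hB,
    lengthMeasure_apply (hB.inter hC), Measure.sum_apply _ hB]
  congr 1
  rw [← indicator_indicator, ← tsum_subtype]
  refine tsum_congr fun c => ?_
  rw [Measure.smul_apply, Measure.dirac_apply' _ hB, smul_eq_mul]
  by_cases h : (c : T) ∈ B <;> simp [h]

theorem treeMeasure_inter (o : T) {C : Set T} (hC : MeasurableSet C) {B : Set T}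
    (hB : MeasurableSet B) : treeMeasure o C (B ∩ C) = treeMeasure o C B := by
  rw [treeMeasure_apply o C hC hB, treeMeasure_apply o C hC (hB.inter hC), inter_assoc, inter_self,
    inter_comm B C, ← inter_assoc, inter_self]

/-- An infimum of differences `t - s` is `t` minus the supremum of the `s`, so the atom at a point
of `C` has the length of the gap that ends there. -/
theorem rootGap_path {o a : T} {C : Set T} (ho : o ∈ C) {t : ℝ} (ht : t ∈ params o a C) :
    rootGap o C (path o a t) = if t = 0 then 0 else t - leftPt (params o a C) t := by
  obtain ⟨htI, htC⟩ := mem_params_iff.1 ht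
  have hd := dist_left_path htI
  rw [rootGap]
  have hiff : path o a t = o ↔ t = 0 := by
    rw [← dist_eq_zero, dist_comm, hd]
  simp only [hiff]
  split_ifs with h
  · rfl
  have ht0 : 0 < t := lt_of_le_of_ne htI.1 (Ne.symm h)
  have hset : dist (path o a t) '' (C ∩ (seg o (path o a t) \ {path o a t})) =
      (fun s => t - s) '' (params o a C ∩ Iio t) := by
    ext r
    constructor
    · rintro ⟨z, ⟨hzC, hz, hne⟩, rfl⟩
      obtain ⟨hz', hle⟩ := (mem_seg_left_iff (path_mem_seg _ _ _)).1 hz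
      rw [hd] at hle
      have hzI := dist_mem_Icc_of_mem_seg hz'
      have hzp := eq_path_of_mem_seg hz'
      refine ⟨dist o z, ⟨mem_params_iff.2 ⟨hzI, hzp ▸ hzC⟩, ?_⟩, ?_⟩
      · refine lt_of_le_of_ne hle fun h => hne ?_
        rw [mem_singleton_iff, hzp, h]
      · have := dist_path htI hzI
        rw [← hzp, abs_of_nonneg (sub_nonneg.2 hle)] at this
        exact this.symm
    · rintro ⟨s, ⟨hs, hst⟩, rfl⟩
      obtain ⟨hsI, hsC⟩ := mem_params_iff.1 hs
      have hst' : s < t := hst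
      refine ⟨path o a s, ⟨hsC, ?_, ?_⟩, ?_⟩
      · refine (mem_seg_left_iff (path_mem_seg _ _ _)).2 ⟨path_mem_seg _ _ _, ?_⟩
        rw [hd, dist_left_path hsI]
        exact hst'.le
      · intro h
        have := dist_left_path hsI
        rw [mem_singleton_iff.1 h, hd] at this
        exact hst'.ne this.symm
      · rw [dist_path htI hsI, abs_of_nonneg (sub_nonneg.2 hst'.le)]
  rw [hset]
  have h0 : (0 : ℝ) ∈ params o a C := mem_params_iff.2
    ⟨left_mem_Icc.2 dist_nonneg, by rwa [path_zero]⟩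
  have hlub : IsLUB (params o a C ∩ Iio t) (leftPt (params o a C) t) :=
    isLUB_csSup ⟨0, h0, ht0⟩ (bddAbove_inter_Iio t)
  refine IsGLB.csInf_eq ⟨?_, ?_⟩ (Nonempty.image _ ⟨0, h0, ht0⟩)
  · rintro _ ⟨s, hs, rfl⟩
    exact sub_le_sub_left (hlub.1 hs) t
  · intro r hr
    have : leftPt (params o a C) t ≤ t - r := hlub.2 fun s hs => by
      have := hr ⟨s, hs, rfl⟩
      simp only at this
      linarith
    linarith

section Closed

variable {C : Set T} {o : T}

theorem zero_mem_params (ho : o ∈ C) (a : T) : (0 : ℝ) ∈ params o a C :=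
  mem_params_iff.2 ⟨left_mem_Icc.2 dist_nonneg, by rwa [path_zero]⟩

theorem dist_mem_params (o : T) {a : T} (ha : a ∈ C) : dist o a ∈ params o a C :=
  mem_params_iff.2 ⟨right_mem_Icc.2 dist_nonneg, by rwa [path_dist]⟩

theorem inter_seg_eq_image (o a : T) (C : Set T) : C ∩ seg o a = path o a '' params o a C := by
  ext z
  constructor
  · rintro ⟨hz, hza⟩
    exact ⟨dist o z, mem_params_iff.2 ⟨dist_mem_Icc_of_mem_seg hza, eq_path_of_mem_seg hza ▸ hz⟩,
      (eq_path_of_mem_seg hza).symm⟩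
  · rintro ⟨t, ht, rfl⟩
    exact ⟨(mem_params_iff.1 ht).2, path_mem_seg _ _ _⟩

theorem injOn_path (o a : T) : InjOn (path o a) (Icc 0 (dist o a)) := by
  intro s hs t ht h
  rw [← dist_left_path hs, ← dist_left_path ht, h]

/-- The identity for which `μ` is designed. It relies on `a ∈ C`: otherwise the length between the
last point of `C` and `a` would be lost. -/
theorem treeMeasure_seg (hC : IsClosed C) (ho : o ∈ C) {a : T} (ha : a ∈ C) :
    treeMeasure o C (seg o a) = ENNReal.ofReal (dist o a) := by
  rw [treeMeasure_apply o C hC.measurableSet (measurableSet_seg o a),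
    length_eq_segLength ((measurableSet_seg o a).inter hC.measurableSet) inter_subset_left,
    segLength, inter_comm, params_inter_seg, ← volume_add_tsum_gaps (params_isClosed o a hC)
      (zero_mem_params ho a) (dist_mem_params o ha) (params_subset o a C)]
  congr 1
  rw [← tsum_subtype, inter_seg_eq_image, tsum_image (fun c => ENNReal.ofReal (rootGap o C c))
      ((injOn_path o a).mono (params_subset _ _ _))]
  refine tsum_congr fun t => ?_
  rw [rootGap_path ho t.2]
  split_ifs <;> simp

/-- Since `μ` is carried by `C`, this replaces a segment from the root with arbitrary end by one
ending in `C`. -/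
theorem exists_last (hC : IsClosed C) (ho : o ∈ C) (x : T) : ∃ z ∈ C, z ∈ seg o x ∧
    dist o z = prevPt (params o x C) (dist o x) ∧ seg o x ∩ C = seg o z ∩ C := by
  have hm := prevPt_mem (params_isClosed o x hC) (zero_mem_params ho x)
    (dist_nonneg (x := o) (y := x))
  obtain ⟨hI, hzC⟩ := mem_params_iff.1 hm.1
  refine ⟨_, hzC, path_mem_seg _ _ _, dist_left_path hI, ?_⟩
  refine Subset.antisymm ?_ (inter_subset_inter_left _ (seg_subset_seg_left (path_mem_seg _ _ _)))
  rintro w ⟨hw, hwC⟩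
  refine ⟨(mem_seg_left_iff (path_mem_seg _ _ _)).2 ⟨hw, ?_⟩, hwC⟩
  rw [dist_left_path hI]
  exact le_prevPt (mem_params_iff.2 ⟨dist_mem_Icc_of_mem_seg hw, eq_path_of_mem_seg hw ▸ hwC⟩)
    (dist_mem_Icc_of_mem_seg hw).2

theorem treeMeasure_seg' (hC : IsClosed C) (ho : o ∈ C) (x : T) :
    treeMeasure o C (seg o x) = ENNReal.ofReal (prevPt (params o x C) (dist o x)) := by
  obtain ⟨z, hzC, -, hd, hi⟩ := exists_last hC ho x
  rw [← treeMeasure_inter o hC.measurableSet (measurableSet_seg o x), hi,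
    treeMeasure_inter o hC.measurableSet (measurableSet_seg o z), treeMeasure_seg hC ho hzC, hd]

theorem treeMeasure_seg_diff (hC : IsClosed C) (ho : o ∈ C) {a c : T} (ha : a ∈ C) (hc : c ∈ C)
    (hca : c ∈ seg o a) : treeMeasure o C (seg o a \ seg o c) = ENNReal.ofReal (dist c a) := by
  rw [measure_sdiff (seg_subset_seg_left hca) (measurableSet_seg o c).nullMeasurableSet
    (by rw [treeMeasure_seg hC ho hc]; exact ENNReal.ofReal_ne_top),
    treeMeasure_seg hC ho ha, treeMeasure_seg hC ho hc, ← ENNReal.ofReal_sub _ dist_nonneg,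
    ← dist_add_dist_of_mem_seg hca, add_sub_cancel_left]

theorem seg_inter_dist_le {o a : T} {t : ℝ} (ht : t ∈ Icc 0 (dist o a)) :
    dist o ⁻¹' Iic t ∩ seg o a = seg o (path o a t) := by
  ext z
  rw [mem_seg_left_iff (path_mem_seg o a t), dist_left_path ht, and_comm]
  rfl

theorem measurable_dist_left (o : T) : Measurable (dist o) :=
  (continuous_const.dist continuous_id).measurable

/-- Seen through the distance to the root, `μ` on `[o,a]` is Lebesgue measure with each gap
collapsed to its right end. Both sides give mass `prevPt t` to the half-line up to `t` when `t ∈ [0,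
d(o,a)]`, and half-lines determine finite measures. -/
theorem map_dist_treeMeasure (hC : IsClosed C) (ho : o ∈ C) {a : T} (ha : a ∈ C) :
    ((treeMeasure o C).restrict (seg o a)).map (dist o) =
      (volume.restrict (Icc 0 (dist o a))).map (nextPt (params o a C)) := by
  set S := params o a C with hSdef
  have hS : IsClosed S := params_isClosed o a hC
  have h0 : (0 : ℝ) ∈ S := zero_mem_params ho a
  have hd : dist o a ∈ S := dist_mem_params o ha
  have hfin : IsFiniteMeasure ((treeMeasure o C).restrict (seg o a)) :=
    ⟨by rw [Measure.restrict_apply_univ, treeMeasure_seg hC ho ha]; exact ENNReal.ofReal_lt_top⟩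
  have hmain : ∀ t ∈ Icc 0 (dist o a), treeMeasure o C (dist o ⁻¹' Iic t ∩ seg o a) =
      volume (nextPt S ⁻¹' Iic t ∩ Icc 0 (dist o a)) := by
    intro t ht
    rw [volume_nextPt_preimage hS h0 hd ht, seg_inter_dist_le ht, treeMeasure_seg' hC ho,
      params_of_mem_seg (path_mem_seg _ _ _), dist_left_path ht, prevPt, prevPt, inter_assoc,
      inter_self]
  refine Measure.ext_of_Iic _ _ fun t => ?_
  rw [Measure.map_apply (measurable_dist_left o) measurableSet_Iic,
    Measure.map_apply_of_aemeasurable (aemeasurable_nextPt hd) measurableSet_Iic,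
    Measure.restrict_apply ((measurable_dist_left o) measurableSet_Iic),
    Measure.restrict_apply' measurableSet_Icc]
  rcases lt_or_ge t 0 with ht | ht
  · have e1 : dist o ⁻¹' Iic t ∩ seg o a = ∅ := by
      refine eq_empty_of_forall_notMem fun z hz => ?_
      have h1 : dist o z ≤ t := hz.1
      linarith [dist_nonneg (x := o) (y := z)]
    have e2 : nextPt S ⁻¹' Iic t ∩ Icc 0 (dist o a) = ∅ := by
      refine eq_empty_of_forall_notMem fun z hz => ?_
      have h1 : nextPt S z ≤ t := hz.1
      have h2 : z ≤ nextPt S z := (nextPt_mem hS hd hz.2.2).2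
      linarith [hz.2.1]
    rw [e1, e2, measure_empty, measure_empty]
  rcases le_total t (dist o a) with htd | htd
  · exact hmain t ⟨ht, htd⟩
  · rw [← (show dist o ⁻¹' Iic (dist o a) ∩ seg o a = dist o ⁻¹' Iic t ∩ seg o a from ?_),
      ← (show nextPt S ⁻¹' Iic (dist o a) ∩ Icc 0 (dist o a) =
        nextPt S ⁻¹' Iic t ∩ Icc 0 (dist o a) from ?_)]
    · exact hmain _ (right_mem_Icc.2 dist_nonneg)
    · ext z
      refine ⟨fun h => ⟨le_trans h.1 htd, h.2⟩, fun h => ⟨nextPt_le hd h.2.2, h.2⟩⟩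
    · ext z
      refine ⟨fun h => ⟨le_trans h.1 htd, h.2⟩, fun h => ⟨(dist_mem_Icc_of_mem_seg h.2).2, h.2⟩⟩

theorem treeMeasure_eq_zero_of_segLength {a : T} (hC : IsClosed C) {N : Set T}
    (hN : MeasurableSet N) (hsub : N ⊆ seg o a) (hnull : segLength o a N = 0)
    (hgap : ∀ c ∈ N, c ∈ C → rootGap o C c ≤ 0) : treeMeasure o C N = 0 := by
  rw [treeMeasure_apply o C hC.measurableSet hN, add_eq_zero]
  constructor
  · rw [← nonpos_iff_eq_zero, ← hnull, ← length_eq_segLength hN hsub]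
    exact length_mono inter_subset_left
  · refine ENNReal.tsum_eq_zero.2 fun c => ?_
    by_cases hc : c ∈ C ∩ N
    · rw [indicator_of_mem hc, ENNReal.ofReal_eq_zero]
      exact hgap c hc.2 hc.1
    · exact indicator_of_notMem hc _

/-- Nullness is local even without `σ`-finiteness: length is a supremum over finite families of
segments, each covered by two segments from the root, and the atom at `c` already lies on `[o,c]`.
-/
theorem treeMeasure_eq_zero_of_forall_seg (hC : IsClosed C) (ho : o ∈ C) {B : Set T}
    (hB : MeasurableSet B) (h : ∀ a ∈ C, treeMeasure o C (B ∩ seg o a) = 0) :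
    treeMeasure o C B = 0 := by
  have hCm := hC.measurableSet
  rw [treeMeasure_apply o C hCm hB, add_eq_zero]
  constructor
  · have hroot : ∀ x, lengthMeasure T (B ∩ C ∩ seg o x) = 0 := by
      intro x
      obtain ⟨z, hzC, -, -, hi⟩ := exists_last hC ho x
      have hm := (hB.inter hCm).inter (measurableSet_seg o x)
      have h1 := treeMeasure_apply o C hCm hm
      rw [inter_assoc, inter_comm C, hi, ← inter_assoc, treeMeasure_inter o hCm
        (hB.inter (measurableSet_seg o z)), h z hzC, eq_comm, add_eq_zero] at h1
      rw [inter_assoc, inter_comm C, hi, ← inter_assoc, lengthMeasure_apply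
        ((hB.inter (measurableSet_seg o z)).inter hCm)]
      have := h1.1
      rwa [inter_assoc _ C C, inter_self] at this
    refine nonpos_iff_eq_zero.1 (iSup₂_le fun R _ => ?_)
    refine (Finset.sum_eq_zero fun p _ => ?_).le
    have hm := (hB.inter hCm).inter (measurableSet_seg p.1 p.2)
    rw [segLength, ← params_inter_seg]
    change segLength p.1 p.2 _ = 0
    rw [← length_eq_segLength hm inter_subset_right, ← lengthMeasure_apply hm]
    refine measure_mono_null ?_ (measure_union_null (hroot p.1) (hroot p.2))
    rw [← inter_union_distrib_left]
    exact inter_subset_inter_right _ (seg_subset_seg_union o p.1 p.2)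
  · refine ENNReal.tsum_eq_zero.2 fun c => ?_
    by_cases hc : c ∈ C ∩ B
    · have h1 := h c hc.1
      rw [treeMeasure_apply o C hCm (hB.inter (measurableSet_seg o c)), add_eq_zero,
        ENNReal.tsum_eq_zero] at h1
      have h2 := h1.2 c
      rw [indicator_of_mem (show c ∈ C ∩ (B ∩ seg o c) from ⟨hc.1, hc.2, right_mem_seg o c⟩)] at h2
      rwa [indicator_of_mem hc]
    · exact indicator_of_notMem hc _

/-- Along a segment ending in `C` only countably many points carry an atom. -/
theorem countable_atoms (ho : o ∈ C) (a : T) :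
    {t ∈ params o a C | 0 < rootGap o C (path o a t)}.Countable := by
  refine countable_rightEnds.mono (s₂ := rightEnds (params o a C)) ?_
  rintro t ⟨ht, hpos⟩
  rw [rootGap_path ho ht] at hpos
  split_ifs at hpos with h
  · exact (lt_irrefl _ hpos).elim
  · exact ⟨ht, lt_of_le_of_ne (params_subset _ _ _ ht).1 (Ne.symm h), sub_pos.1 hpos⟩

end Closed

end

end RTree

/-! ### Indicator functions in `L₁` -/

namespace MeasureTheory

noncomputable section

open Filter Classical in
/-- The indicator function of `B` as an element of `L₁(μ)`, or `0` if `B` is not a measurable set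
of finite measure. -/
def indL1 {X : Type*} [MeasurableSpace X] (μ : Measure X) (B : Set X) : Lp ℝ 1 μ :=
  if h : MeasurableSet B ∧ μ B ≠ ∞ then indicatorConstLp 1 h.1 h.2 1 else 0

section Indicator

open Filter

variable {X : Type*} [MeasurableSpace X] {μ : Measure X} {B B' : Set X}

theorem indL1_eq (hB : MeasurableSet B) (hμ : μ B ≠ ∞) :
    indL1 μ B = indicatorConstLp 1 hB hμ 1 := by
  rw [indL1, dif_pos ⟨hB, hμ⟩]

theorem coeFn_indL1 (hB : MeasurableSet B) (hμ : μ B ≠ ∞) :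
    indL1 μ B =ᵐ[μ] B.indicator fun _ => 1 := by
  rw [indL1_eq hB hμ]
  exact indicatorConstLp_coeFn

theorem norm_indL1 (hB : MeasurableSet B) (hμ : μ B ≠ ∞) : ‖indL1 μ B‖ = μ.real B := by
  rw [indL1_eq hB hμ, norm_indicatorConstLp one_ne_zero ENNReal.one_ne_top]
  simp

theorem indL1_union (hB : MeasurableSet B) (hμ : μ B ≠ ∞) (hB' : MeasurableSet B')
    (hμ' : μ B' ≠ ∞) (hd : Disjoint B B') : indL1 μ (B ∪ B') = indL1 μ B + indL1 μ B' := by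
  rw [indL1_eq hB hμ, indL1_eq hB' hμ', indL1_eq (hB.union hB')
    (measure_union_lt_top hμ.lt_top hμ'.lt_top).ne]
  exact indicatorConstLp_disjoint_union hB hB' hμ hμ' hd 1

theorem indL1_diff (hB : MeasurableSet B) (hμ : μ B ≠ ∞) (hB' : MeasurableSet B')
    (hsub : B' ⊆ B) : indL1 μ (B \ B') = indL1 μ B - indL1 μ B' := by
  rw [eq_sub_iff_add_eq, ← indL1_union (hB.diff hB')
    (ne_top_of_le_ne_top hμ (measure_mono sdiff_subset)) hB'
    (ne_top_of_le_ne_top hμ (measure_mono hsub)) disjoint_sdiff_left, sdiff_union_of_subset hsub]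

theorem indL1_of_measure_eq_zero (hB : MeasurableSet B) (hμ : μ B = 0) : indL1 μ B = 0 := by
  have : μ B ≠ ∞ := by simp [hμ]
  rw [← norm_eq_zero, norm_indL1 hB this, measureReal_def, hμ, ENNReal.toReal_zero]

theorem indL1_eq_of_diff_null (hB : MeasurableSet B) (hμ : μ B ≠ ∞) (hB' : MeasurableSet B')
    (hsub : B' ⊆ B) (h0 : μ (B \ B') = 0) : indL1 μ B = indL1 μ B' := by
  rw [← sub_eq_zero, ← indL1_diff hB hμ hB' hsub]
  exact indL1_of_measure_eq_zero (hB.diff hB') h0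

variable {V : Submodule ℝ (Lp ℝ 1 μ)}

theorem indL1_union_mem (hB : MeasurableSet B) (hμ : μ B ≠ ∞) (hB' : MeasurableSet B')
    (hμ' : μ B' ≠ ∞) (hd : Disjoint B B') (h : indL1 μ B ∈ V) (h' : indL1 μ B' ∈ V) :
    indL1 μ (B ∪ B') ∈ V := by
  rw [indL1_union hB hμ hB' hμ' hd]
  exact V.add_mem h h'

theorem indL1_iUnion_mem_of_monotone (hV : IsClosed (V : Set (Lp ℝ 1 μ))) {U : ℕ → Set X}
    (hU : ∀ n, MeasurableSet (U n)) (hmono : Monotone U) (hμ : μ (⋃ n, U n) ≠ ∞)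
    (h : ∀ n, indL1 μ (U n) ∈ V) : indL1 μ (⋃ n, U n) ∈ V := by
  have hm := MeasurableSet.iUnion hU
  have hfin : ∀ n, μ (U n) ≠ ∞ := fun n => ne_top_of_le_ne_top hμ (measure_mono (subset_iUnion U n))
  refine hV.mem_of_tendsto (b := atTop) (f := fun n => indL1 μ (U n)) ?_ (Eventually.of_forall h)
  rw [tendsto_iff_norm_sub_tendsto_zero]
  have hn : ∀ n, ‖indL1 μ (U n) - indL1 μ (⋃ n, U n)‖ = μ.real (⋃ n, U n) - μ.real (U n) := by
    intro n
    rw [norm_sub_rev, ← indL1_diff hm hμ (hU n) (subset_iUnion U n), norm_indL1 (hm.diff (hU n))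
      (ne_top_of_le_ne_top hμ (measure_mono sdiff_subset)),
      measureReal_sdiff (subset_iUnion U n) (hU n) hμ]
  simp only [hn]
  have ht := (ENNReal.tendsto_toReal hμ).comp (tendsto_measure_iUnion_atTop (μ := μ) hmono)
  have := (tendsto_const_nhds (x := μ.real (⋃ n, U n))).sub ht
  rwa [measureReal_def, sub_self] at this

theorem indL1_iUnion_mem_of_disjoint (hV : IsClosed (V : Set (Lp ℝ 1 μ))) {U : ℕ → Set X}
    (hU : ∀ n, MeasurableSet (U n)) (hd : Pairwise (Function.onFun Disjoint U))
    (hμ : μ (⋃ n, U n) ≠ ∞) (h : ∀ n, indL1 μ (U n) ∈ V) : indL1 μ (⋃ n, U n) ∈ V := by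
  have hfin : ∀ n, μ (U n) ≠ ∞ := fun n => ne_top_of_le_ne_top hμ (measure_mono (subset_iUnion U n))
  have hms : ∀ n, MeasurableSet (accumulate U n) := fun n =>
    MeasurableSet.biUnion (to_countable _) fun k _ => hU k
  have hms_fin : ∀ n, μ (accumulate U n) ≠ ∞ := fun n =>
    ne_top_of_le_ne_top hμ (measure_mono (iUnion₂_subset fun k _ => subset_iUnion U k))
  rw [← iUnion_accumulate] at hμ ⊢
  refine indL1_iUnion_mem_of_monotone hV hms monotone_accumulate hμ fun n => ?_
  induction n with
  | zero => rw [accumulate_zero_nat]; exact h 0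
  | succ n ih =>
    rw [accumulate_succ]
    refine indL1_union_mem (hms n) (hms_fin n) (hU _) (hfin _) ?_ ih (h _)
    simp only [accumulate_def, disjoint_iUnion_left]
    intro k hk
    exact hd (by omega)

/-- `V` contains the indicator functions of all sets of finite measure contained in `W`. -/
def ContainsInd (V : Submodule ℝ (Lp ℝ 1 μ)) (W : Set X) : Prop :=
  ∀ B, MeasurableSet B → μ B ≠ ∞ → indL1 μ (B ∩ W) ∈ V

theorem containsInd_empty : ContainsInd V (∅ : Set X) := by
  intro B _ _
  rw [inter_empty, indL1_of_measure_eq_zero MeasurableSet.empty measure_empty]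
  exact V.zero_mem

/-- The quantification over all `B` in `ContainsInd` pays off here: the part of `B` in `W' \ W` is
handled by applying the second hypothesis to `B \ W`. -/
theorem ContainsInd.union {W W' : Set X} (hW : MeasurableSet W) (hW' : MeasurableSet W')
    (h : ContainsInd V W) (h' : ContainsInd V W') : ContainsInd V (W ∪ W') := by
  intro B hB hμ
  have hfin : ∀ {D}, D ⊆ B → μ D ≠ ∞ := fun hD => ne_top_of_le_ne_top hμ (measure_mono hD)
  have heq : B ∩ (W ∪ W') = (B ∩ W) ∪ ((B \ W) ∩ W') := by
    ext z
    by_cases hz : z ∈ W <;> simp [hz]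
  rw [heq]
  refine indL1_union_mem (hB.inter hW) (hfin inter_subset_left) ((hB.diff hW).inter hW')
    (hfin (inter_subset_left.trans sdiff_subset)) ?_ (h B hB hμ)
    (h' _ (hB.diff hW) (hfin sdiff_subset))
  exact disjoint_sdiff_right.mono inter_subset_right inter_subset_left

theorem ContainsInd.iUnion (hV : IsClosed (V : Set (Lp ℝ 1 μ))) {W : ℕ → Set X}
    (hW : ∀ n, MeasurableSet (W n)) (h : ∀ n, ContainsInd V (W n)) :
    ContainsInd V (⋃ n, W n) := by
  have hms : ∀ n, MeasurableSet (accumulate W n) := fun n =>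
    MeasurableSet.biUnion (to_countable _) fun k _ => hW k
  have hc : ∀ n, ContainsInd V (accumulate W n) := by
    intro n
    induction n with
    | zero => rw [accumulate_zero_nat]; exact h 0
    | succ n ih => rw [accumulate_succ]; exact ih.union (hms n) (hW _) (h _)
  intro B hB hμ
  rw [← iUnion_accumulate, inter_iUnion]
  refine indL1_iUnion_mem_of_monotone hV (fun n => hB.inter (hms n))
    (fun m n hmn => inter_subset_inter_right _ (monotone_accumulate hmn)) ?_ fun n => hc n B hB hμ
  exact ne_top_of_le_ne_top hμ (measure_mono (iUnion_subset fun n => inter_subset_left))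

theorem eq_top_of_indL1_mem (hV : IsClosed (V : Set (Lp ℝ 1 μ)))
    (h : ∀ B, MeasurableSet B → μ B ≠ ∞ → indL1 μ B ∈ V) : V = ⊤ := by
  refine eq_top_iff.2 fun f _ => ?_
  refine Lp.induction ENNReal.one_ne_top (fun f => f ∈ V) ?_ ?_ hV f
  · intro c s hs hμs
    have h1 : (Lp.simpleFunc.indicatorConst 1 hs hμs.ne c : Lp ℝ 1 μ) = c • indL1 μ s := by
      rw [Lp.simpleFunc.coe_indicatorConst, indL1_eq hs hμs.ne]
      ext1
      filter_upwards [indicatorConstLp_coeFn (p := 1) (hs := hs) (hμs := hμs.ne) (c := c),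
        Lp.coeFn_smul c (indicatorConstLp 1 hs hμs.ne (1 : ℝ)),
        indicatorConstLp_coeFn (p := 1) (hs := hs) (hμs := hμs.ne) (c := (1 : ℝ))] with x h1 h2 h3
      rw [h1, h2, Pi.smul_apply, h3]
      by_cases hx : x ∈ s <;> simp [hx]
    rw [h1]
    exact V.smul_mem c (h s hs hμs.ne)
  · intro f g hf hg _ hfV hgV
    exact V.add_mem hfV hgV

end Indicator

end

end MeasureTheory

/-! ### Density in `L₁(μ)` of the span of indicators of segments from the root -/

namespace RTree

open ClosedGaps Filter

noncomputable section

variable {T : Type*} [MetricSpace T] [RTree T] {C : Set T} {o : T}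

theorem treeMeasure_seg_ne_top (hC : IsClosed C) (ho : o ∈ C) (x : T) :
    treeMeasure o C (seg o x) ≠ ∞ := by
  rw [treeMeasure_seg' hC ho]
  exact ENNReal.ofReal_ne_top

/-- Needed for the truncations of a segment at a given distance from the root, whose end may fall in
a gap. -/
theorem indL1_seg_eq (hC : IsClosed C) (ho : o ∈ C) (x : T) :
    ∃ z ∈ C, indL1 (treeMeasure o C) (seg o x) = indL1 (treeMeasure o C) (seg o z) := by
  obtain ⟨z, hzC, hz, -, hi⟩ := exists_last hC ho x
  refine ⟨z, hzC, indL1_eq_of_diff_null (measurableSet_seg o x) (treeMeasure_seg_ne_top hC ho x)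
    (measurableSet_seg o z) (seg_subset_seg_left hz) ?_⟩
  rw [← treeMeasure_inter o hC.measurableSet ((measurableSet_seg o x).diff (measurableSet_seg o z))]
  convert! measure_empty (μ := treeMeasure o C)
  refine eq_empty_of_forall_notMem fun w hw => hw.1.2 ?_
  exact (hi ▸ (⟨hw.1.1, hw.2⟩ : w ∈ seg o x ∩ C) : w ∈ seg o z ∩ C).1

/-- The condition on branching points is used here: it puts the meet `c` of `a` and `b` in `C`, so
that `[o,a] \ [o,c]` and `[o,b] \ [o,c]` have measures `d(c,a)` and `d(c,b)`, with sum `d(a,b)`. -/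
theorem norm_indL1_seg_sub_le (hC : IsClosed C) (hbr : branchingPoints T ⊆ C) (ho : o ∈ C)
    {a b : T} (ha : a ∈ C) (hb : b ∈ C) :
    ‖indL1 (treeMeasure o C) (seg o a) - indL1 (treeMeasure o C) (seg o b)‖ ≤ dist a b := by
  obtain ⟨c, hc, hca, hcb, hab⟩ := exists_meet hbr ho ha hb
  have key : ∀ {e}, e ∈ C → c ∈ seg o e →
      ‖indL1 (treeMeasure o C) (seg o e) - indL1 (treeMeasure o C) (seg o c)‖ = dist c e := by
    intro e he hce
    have hfin := treeMeasure_seg_ne_top hC ho e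
    rw [← indL1_diff (measurableSet_seg o e) hfin (measurableSet_seg o c)
      (seg_subset_seg_left hce), norm_indL1 ((measurableSet_seg o e).diff (measurableSet_seg o c))
      (ne_top_of_le_ne_top hfin (measure_mono sdiff_subset)), measureReal_def,
      treeMeasure_seg_diff hC ho he hc hce, ENNReal.toReal_ofReal dist_nonneg]
  refine (norm_sub_le_norm_sub_add_norm_sub _ (indL1 (treeMeasure o C) (seg o c)) _).trans ?_
  rw [key ha hca, norm_sub_rev, key hb hcb, dist_comm c a]
  exact (dist_add_dist_of_mem_seg hab).le

section Density

variable {V : Submodule ℝ (Lp ℝ 1 (treeMeasure o C))}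

/-- A `π`-`λ` argument along `[o,a]`: half-lines cut out shorter segments from the root, and a
closed subspace is stable under relative complements and countable disjoint unions. -/
theorem indL1_preimage_dist_mem (hC : IsClosed C) (ho : o ∈ C)
    (hV : IsClosed (V : Set (Lp ℝ 1 (treeMeasure o C))))
    (h : ∀ a ∈ C, indL1 (treeMeasure o C) (seg o a) ∈ V) {a : T} (ha : a ∈ C) {E : Set ℝ}
    (hE : MeasurableSet E) : indL1 (treeMeasure o C) (dist o ⁻¹' E ∩ seg o a) ∈ V := by
  have hm : ∀ {E : Set ℝ}, MeasurableSet E → MeasurableSet (dist o ⁻¹' E ∩ seg o a) := fun hE =>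
    ((measurable_dist_left o) hE).inter (measurableSet_seg o a)
  have hfin : ∀ {B}, B ⊆ seg o a → treeMeasure o C B ≠ ∞ := fun hB =>
    ne_top_of_le_ne_top (treeMeasure_seg_ne_top hC ho a) (measure_mono hB)
  have hempty : indL1 (treeMeasure o C) ∅ ∈ V := by
    rw [indL1_of_measure_eq_zero MeasurableSet.empty measure_empty]
    exact V.zero_mem
  induction E, hE using MeasurableSpace.induction_on_inter (borel_eq_generateFrom_Iic ℝ)
    isPiSystem_Iic with
  | empty => simpa using hempty
  | basic E hE =>
    obtain ⟨t, rfl⟩ := hE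
    rcases lt_or_ge t 0 with ht | ht
    · have e1 : dist o ⁻¹' Iic t ∩ seg o a = ∅ := by
        refine eq_empty_of_forall_notMem fun z hz => ?_
        have h1 : dist o z ≤ t := hz.1
        linarith [dist_nonneg (x := o) (y := z)]
      rwa [e1]
    rcases le_total t (dist o a) with htd | htd
    · rw [seg_inter_dist_le ⟨ht, htd⟩]
      obtain ⟨z, hz, hzeq⟩ := indL1_seg_eq hC ho (path o a t)
      rw [hzeq]
      exact h z hz
    · have hsub : seg o a ⊆ dist o ⁻¹' Iic t := fun z hz =>
        (dist_mem_Icc_of_mem_seg hz).2.trans htd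
      rw [inter_eq_right.2 hsub]
      exact h a ha
  | compl E hE ih =>
    have : dist o ⁻¹' Eᶜ ∩ seg o a = seg o a \ (dist o ⁻¹' E ∩ seg o a) := by
      ext z
      by_cases hz : z ∈ seg o a <;> simp [hz]
    rw [this, indL1_diff (measurableSet_seg o a) (hfin subset_rfl) (hm hE) inter_subset_right]
    exact V.sub_mem (h a ha) ih
  | iUnion E hd hE ih =>
    rw [preimage_iUnion, iUnion_inter]
    refine indL1_iUnion_mem_of_disjoint hV (fun n => hm (hE n)) ?_
      (hfin (iUnion_subset fun n => inter_subset_right)) ih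
    intro m n hmn
    exact ((hd hmn).preimage _).mono inter_subset_left inter_subset_left

/-- Measurability in `T` is only Lebesgue measurability of parameters, so `B` is replaced by a set
with Borel parameters. A Lebesgue-null change may still hit atoms; as these are countably many on
`[o,a]`, the Borel set can be made to agree with `B` at each of them. -/
theorem indL1_inter_seg_mem (hC : IsClosed C) (ho : o ∈ C)
    (hV : IsClosed (V : Set (Lp ℝ 1 (treeMeasure o C))))
    (h : ∀ a ∈ C, indL1 (treeMeasure o C) (seg o a) ∈ V) {a : T} (ha : a ∈ C) {B : Set T}
    (hB : MeasurableSet B) : indL1 (treeMeasure o C) (B ∩ seg o a) ∈ V := by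
  set P := params o a B with hP
  set S₀ := {t ∈ params o a C | 0 < rootGap o C (path o a t)} with hS₀
  have hS₀c : S₀.Countable := countable_atoms ho a
  obtain ⟨E₁, hPE, hE₁, hE₁P⟩ := (hB o a).exists_measurable_superset_ae_eq
  -- Borel superset of `P` off the atoms, `P` itself on them.
  set E := (E₁ \ S₀) ∪ (P ∩ S₀) with hE
  have hEm : MeasurableSet E := (hE₁.diff hS₀c.measurableSet).union
    (hS₀c.mono inter_subset_right).measurableSet
  have hm := ((measurable_dist_left o) hEm).inter (measurableSet_seg o a)
  have hfin := ne_top_of_le_ne_top (treeMeasure_seg_ne_top hC ho a)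
    (measure_mono (inter_subset_right (s := dist o ⁻¹' E)))
  have hBm := hB.inter (measurableSet_seg o a)
  have hsub : B ∩ seg o a ⊆ dist o ⁻¹' E ∩ seg o a := by
    rintro z ⟨hz, hza⟩
    refine ⟨?_, hza⟩
    have hzP : dist o z ∈ P :=
      mem_params_iff.2 ⟨dist_mem_Icc_of_mem_seg hza, eq_path_of_mem_seg hza ▸ hz⟩
    by_cases h0 : dist o z ∈ S₀
    · exact Or.inr ⟨hzP, h0⟩
    · exact Or.inl ⟨hPE hzP, h0⟩
  rw [← indL1_eq_of_diff_null hm hfin hBm hsub]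
  · exact indL1_preimage_dist_mem hC ho hV h ha hEm
  have hkey : ∀ z ∈ (dist o ⁻¹' E ∩ seg o a) \ (B ∩ seg o a),
      dist o z ∈ E₁ \ P ∧ dist o z ∉ S₀ := by
    rintro z ⟨⟨hzE, hza⟩, hzB⟩
    have hzP : dist o z ∉ P := fun h' => hzB ⟨by
      rw [eq_path_of_mem_seg hza]; exact (mem_params_iff.1 h').2, hza⟩
    rcases hzE with hzE | hzE
    · exact ⟨⟨hzE.1, hzP⟩, hzE.2⟩
    · exact (hzP hzE.1).elim
  refine treeMeasure_eq_zero_of_segLength (a := a) hC (hm.diff hBm)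
    (sdiff_subset.trans inter_subset_right) ?_ ?_
  · refine measure_mono_null ?_ (ae_le_set.1 hE₁P.le)
    intro t ht
    obtain ⟨htI, ht⟩ := mem_params_iff.1 ht
    have := (hkey _ ht).1
    rwa [dist_left_path htI] at this
  · intro c hc hcC
    by_contra! hpos
    have hca : c ∈ seg o a := hc.1.2
    refine (hkey c hc).2 ⟨mem_params_iff.2 ⟨dist_mem_Icc_of_mem_seg hca,
      eq_path_of_mem_seg hca ▸ hcC⟩, ?_⟩
    rwa [← eq_path_of_mem_seg hca]

/-- A set of finite measure is covered, up to a null set, by countably many segments issuing from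
the root and ending in `C`. -/
theorem exists_seq_finset_seg (hC : IsClosed C) (ho : o ∈ C) {B : Set T} (hB : MeasurableSet B)
    (hμ : treeMeasure o C B ≠ ∞) : ∃ F : ℕ → Finset T, (∀ n, (F n : Set T) ⊆ C) ∧
      treeMeasure o C (B \ ⋃ n, ⋃ a ∈ F n, seg o a) = 0 := by
  classical
  set μ := treeMeasure o C with hμdef
  let W : Finset T → Set T := fun F => ⋃ a ∈ F, seg o a
  have hW : ∀ F, MeasurableSet (W F) := fun F => F.measurableSet_biUnion fun a _ =>
    measurableSet_seg o a
  let m : {F : Finset T // (F : Set T) ⊆ C} → ℝ≥0∞ := fun F => μ (B ∩ W F.1)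
  have : Nonempty {F : Finset T // (F : Set T) ⊆ C} := ⟨⟨∅, by simp⟩⟩
  -- Exhaustion: choose finite unions of segments whose traces on `B` have measures tending to the
  -- supremum.
  obtain ⟨u, -, hu, hum⟩ := exists_seq_tendsto_sSup (range_nonempty m) (OrderTop.bddAbove _)
  choose F hF using hum
  have hle : ∀ G, m G ≤ sSup (range m) := fun G => le_sSup ⟨G, rfl⟩
  have htop : sSup (range m) ≠ ∞ := ne_top_of_le_ne_top hμ (sSup_le (by
    rintro _ ⟨G, rfl⟩
    exact measure_mono inter_subset_left))
  refine ⟨fun n => (F n).1, fun n => (F n).2, ?_⟩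
  have hWm : MeasurableSet (⋃ n, W (F n).1) := MeasurableSet.iUnion fun n => hW _
  refine treeMeasure_eq_zero_of_forall_seg hC ho (hB.diff hWm) fun a ha => ?_
  set D := (B \ ⋃ n, W (F n).1) ∩ seg o a with hD
  have hDm : MeasurableSet D := (hB.diff hWm).inter (measurableSet_seg o a)
  -- Adding `[o,a]` to the `n`-th family gains at least `μ D` without exceeding the supremum, which
  -- is finite; in the limit `μ D = 0`.
  have hstep : ∀ n, u n + μ D ≤ sSup (range m) := by
    intro n
    refine le_trans ?_ (hle ⟨insert a (F n).1, by
      rw [Finset.coe_insert]; exact insert_subset ha (F n).2⟩)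
    rw [← hF n, ← measure_union _ hDm]
    · refine measure_mono (union_subset ?_ ?_)
      · exact inter_subset_inter_right _ (biUnion_subset_biUnion_left (Finset.subset_insert _ _))
      · exact fun z hz => ⟨hz.1.1, mem_biUnion (Finset.mem_insert_self _ _) hz.2⟩
    · rw [Set.disjoint_left]
      exact fun z hz hz' => hz'.1.2 (mem_iUnion.2 ⟨n, hz.2⟩)
  have hlim := le_of_tendsto (hu.add_const (μ D)) (Eventually.of_forall hstep)
  have h0 : sSup (range m) + μ D ≤ sSup (range m) + 0 := by rwa [add_zero]
  exact nonpos_iff_eq_zero.1 ((ENNReal.add_le_add_iff_left htop).1 h0)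

theorem eq_top_of_indL1_seg_mem (hC : IsClosed C) (ho : o ∈ C)
    (hV : IsClosed (V : Set (Lp ℝ 1 (treeMeasure o C))))
    (h : ∀ a ∈ C, indL1 (treeMeasure o C) (seg o a) ∈ V) : V = ⊤ := by
  classical
  refine eq_top_of_indL1_mem hV fun B hB hμ => ?_
  obtain ⟨F, hF, h0⟩ := exists_seq_finset_seg hC ho hB hμ
  have hWm : ∀ G : Finset T, MeasurableSet (⋃ a ∈ G, seg o a) := fun G =>
    G.measurableSet_biUnion fun a _ => measurableSet_seg o a
  have hfin : ∀ G : Finset T, (G : Set T) ⊆ C → ContainsInd V (⋃ a ∈ G, seg o a) := by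
    intro G
    induction G using Finset.induction_on with
    | empty => intro _; simpa using containsInd_empty
    | insert a G _ ih =>
      intro hG
      rw [Finset.coe_insert, insert_subset_iff] at hG
      rw [Finset.set_biUnion_insert]
      exact ContainsInd.union (measurableSet_seg o a) (hWm G)
        (fun B hB _ => indL1_inter_seg_mem hC ho hV h hG.1 hB) (ih hG.2)
  have hW := ContainsInd.iUnion hV (fun n => hWm (F n)) fun n => hfin (F n) (hF n)
  rw [indL1_eq_of_diff_null hB hμ (hB.inter (MeasurableSet.iUnion fun n => hWm (F n)))
    inter_subset_left (by rwa [sdiff_self_inter])]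
  exact hW B hB hμ

/-- The map `a ↦ 1_[o,a]` is 1-Lipschitz on the closure of `A`, so a closed subspace containing its
values on `A` contains them all. -/
theorem eq_top_of_indL1_seg_mem_of_closure {A : Set T} (hbr : branchingPoints T ⊆ closure A)
    (ho : o ∈ closure A) {V : Submodule ℝ (Lp ℝ 1 (treeMeasure o (closure A)))}
    (hV : IsClosed (V : Set (Lp ℝ 1 (treeMeasure o (closure A)))))
    (h : ∀ a ∈ A, indL1 (treeMeasure o (closure A)) (seg o a) ∈ V) : V = ⊤ := by
  refine eq_top_of_indL1_seg_mem isClosed_closure ho hV fun a ha => ?_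
  obtain ⟨u, huA, hu⟩ := mem_closure_iff_seq_limit.1 ha
  refine hV.mem_of_tendsto (b := atTop)
    (f := fun n => indL1 (treeMeasure o (closure A)) (seg o (u n))) ?_
    (Eventually.of_forall fun n => h _ (huA n))
  rw [tendsto_iff_norm_sub_tendsto_zero]
  exact squeeze_zero (fun _ => norm_nonneg _)
    (fun n => norm_indL1_seg_sub_le isClosed_closure hbr ho (subset_closure (huA n)) ha)
    (tendsto_iff_dist_tendsto_zero.1 hu)

end Density

end

end RTree

/-! ### Densities of Lipschitz functions -/

namespace RTree

open ClosedGaps Filter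

noncomputable section

variable {T : Type*} [MetricSpace T] [RTree T] {C : Set T} {o : T}

/-- The derivative of `F` at `x` in the direction of the root `o`, relative to `C`. -/
def rootSlope (o : T) (C : Set T) (F : T → ℝ) (x : T) : ℝ :=
  slopeLim (params o x C) (F ∘ path o x) (dist o x)

theorem lipschitzWith_comp_path {F : T → ℝ} {K : ℝ≥0} (hF : LipschitzWith K F) (o x : T) :
    LipschitzWith K (F ∘ path o x) := by
  have := hF.comp (lipschitzWith_path o x)
  rwa [mul_one] at this

theorem abs_rootSlope_le {F : T → ℝ} {K : ℝ≥0} (hF : LipschitzWith K F) (o x : T) :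
    |rootSlope o C F x| ≤ K :=
  abs_slopeLim_le (lipschitzWith_comp_path hF o x) _

/-- The slope at `x` looks only backwards along `[o,x]`, an initial piece of any `[o,a]` through
`x`. One function on the tree thus restricts to the one-dimensional density on every segment from
the root. -/
theorem rootSlope_of_mem_seg (ho : o ∈ C) (F : T → ℝ) {a x : T} (hx : x ∈ seg o a) :
    rootSlope o C F x = slopeLim (params o a C) (F ∘ path o a) (dist o x) := by
  rw [rootSlope, slopeLim, slopeLim]
  congr 1
  ext n
  have hn0 : 0 < 1 / ((n : ℝ) + 1) := Nat.one_div_pos_of_nat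
  set r := max 0 (dist o x - 1 / ((n : ℝ) + 1)) with hr
  have hr0 : 0 ≤ r := le_max_left _ _
  have hrx : r ≤ dist o x := max_le dist_nonneg (by linarith)
  have hprev : prevPt (params o x C) r = prevPt (params o a C) r := by
    rw [params_of_mem_seg hx, prevPt, prevPt, inter_assoc, Iic_inter_Iic, min_eq_right hrx]
  have h0 := prevPt_nonneg (zero_mem_params ho a) hr0
  have hle : prevPt (params o a C) r ≤ r :=
    csSup_le ⟨0, zero_mem_params ho a, hr0⟩ fun _ h => h.2
  simp only [Function.comp_apply]
  rw [hprev, path_eq_path_of_mem_seg hx ⟨h0, hle.trans hrx⟩,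
    path_eq_path_of_mem_seg hx (right_mem_Icc.2 dist_nonneg)]

theorem measurable_rootSlope (ho : o ∈ C) {F : T → ℝ} (hF : Continuous F) :
    Measurable (rootSlope o C F) := by
  intro E hE
  refine measurableSet_of_root o fun a => ?_
  have hm : Measurable (slopeLim (params o a C) (F ∘ path o a)) :=
    measurable_slopeLim (zero_mem_params ho a) (hF.comp (lipschitzWith_path o a).continuous)
  have : params o a (rootSlope o C F ⁻¹' E) =
      Icc 0 (dist o a) ∩ slopeLim (params o a C) (F ∘ path o a) ⁻¹' E := by
    ext t
    rw [mem_params_iff, mem_inter_iff, and_congr_right_iff]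
    intro ht
    rw [mem_preimage, mem_preimage, rootSlope_of_mem_seg ho F (path_mem_seg o a t),
      dist_left_path ht]
  rw [this]
  exact (measurableSet_Icc.inter (hm hE)).nullMeasurableSet

/-- The integral is transported by `dist o` to the real line, where `map_dist_treeMeasure` turns it
into the integral of `slopeLim ∘ nextPt`. -/
theorem integral_rootSlope (hC : IsClosed C) (ho : o ∈ C) {F : T → ℝ} {K : ℝ≥0}
    (hF : LipschitzWith K F) {a : T} (ha : a ∈ C) :
    ∫ x in seg o a, rootSlope o C F x ∂(treeMeasure o C) = F a - F o := by
  have hH := lipschitzWith_comp_path hF o a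
  have hd := dist_mem_params o ha
  have h0 := zero_mem_params ho a
  have hm := (measurable_slopeLim h0 hH.continuous).stronglyMeasurable
  rw [setIntegral_congr_fun (measurableSet_seg o a) fun x hx => rootSlope_of_mem_seg ho F hx,
    ← integral_map (measurable_dist_left o).aemeasurable hm.aestronglyMeasurable,
    map_dist_treeMeasure hC ho ha, integral_map (aemeasurable_nextPt hd) hm.aestronglyMeasurable,
    integral_slopeLim_nextPt (params_isClosed o a hC) h0 hd (params_subset o a C) hH,
    Function.comp_apply, Function.comp_apply, path_dist, path_zero]

end

end RTree

/-! ### The pairing of `L₁` and `L_∞` -/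

namespace MeasureTheory

noncomputable section

variable {X : Type*} [MeasurableSpace X] {μ : Measure X}

variable (μ) in
/-- The pairing `(h, g) ↦ ∫ h g dμ` of `L₁(μ)` and `L_∞(μ)`. -/
def l1Pairing : Lp ℝ 1 μ →L[ℝ] Lp ℝ ∞ μ →L[ℝ] ℝ :=
  (ContinuousLinearMap.mul ℝ ℝ).lpPairing μ 1 ∞

theorem l1Pairing_apply (h : Lp ℝ 1 μ) (g : Lp ℝ ∞ μ) : l1Pairing μ h g = ∫ x, h x * g x ∂μ :=
  ContinuousLinearMap.lpPairing_eq_integral _ _ _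

theorem ae_abs_le_norm_top (g : Lp ℝ ∞ μ) : ∀ᵐ x ∂μ, |g x| ≤ ‖g‖ := by
  have htop : eLpNormEssSup g μ ≠ ∞ := by
    rw [← eLpNorm_exponent_top]
    exact Lp.eLpNorm_ne_top g
  filter_upwards [ae_le_eLpNormEssSup (f := g) (μ := μ)] with x hx
  rw [Lp.norm_def, eLpNorm_exponent_top, ← Real.norm_eq_abs, ← toReal_enorm]
  exact ENNReal.toReal_mono htop hx

theorem norm_toLp_top_le {g : X → ℝ} (hg : AEStronglyMeasurable g μ) {K : ℝ} (hK : 0 ≤ K)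
    (hgK : ∀ x, |g x| ≤ K) :
    ‖(memLp_top_of_bound hg K (Filter.Eventually.of_forall hgK)).toLp g‖ ≤ K := by
  rw [Lp.norm_toLp, eLpNorm_exponent_top]
  exact ENNReal.toReal_le_of_le_ofReal hK
    (eLpNormEssSup_le_of_ae_bound (Filter.Eventually.of_forall hgK))

theorem abs_l1Pairing_le (h : Lp ℝ 1 μ) (g : Lp ℝ ∞ μ) : |l1Pairing μ h g| ≤ ‖h‖ * ‖g‖ := by
  rw [l1Pairing_apply, L1.norm_eq_integral_norm, ← integral_mul_const, ← Real.norm_eq_abs]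
  refine norm_integral_le_of_norm_le ((L1.integrable_coeFn h).norm.mul_const _) ?_
  filter_upwards [ae_abs_le_norm_top g] with x hx
  rw [norm_mul]
  exact mul_le_mul_of_nonneg_left hx (norm_nonneg _)

theorem l1Pairing_indL1 {B : Set X} (hB : MeasurableSet B) (hμ : μ B ≠ ∞) (g : Lp ℝ ∞ μ) :
    l1Pairing μ (indL1 μ B) g = ∫ x in B, g x ∂μ := by
  rw [l1Pairing_apply, ← integral_indicator hB]
  refine integral_congr_ae ?_
  filter_upwards [coeFn_indL1 hB hμ] with x hx
  rw [hx]
  by_cases h : x ∈ B <;> simp [h]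

theorem integrableOn_of_top {B : Set X} (hμ : μ B ≠ ∞) (g : Lp ℝ ∞ μ) : IntegrableOn g B μ :=
  Measure.integrableOn_of_bounded hμ (Lp.aestronglyMeasurable g)
    (ae_restrict_of_ae (ae_abs_le_norm_top g))

/-- The norm of `L₁` is attained on the unit ball of `L_∞`. -/
theorem exists_l1Pairing_eq_norm (h : Lp ℝ 1 μ) :
    ∃ g : Lp ℝ ∞ μ, ‖g‖ ≤ 1 ∧ l1Pairing μ h g = ‖h‖ := by
  classical
  set s : X → ℝ := fun x => if 0 ≤ h x then 1 else -1 with hs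
  have hm : Measurable s := Measurable.ite
    ((Lp.stronglyMeasurable h).measurable measurableSet_Ici) measurable_const measurable_const
  have hb : ∀ x, |s x| ≤ 1 := by
    intro x
    simp only [hs]
    split_ifs <;> simp
  refine ⟨_, norm_toLp_top_le hm.aestronglyMeasurable zero_le_one hb, ?_⟩
  rw [l1Pairing_apply, L1.norm_eq_integral_norm]
  refine integral_congr_ae ?_
  filter_upwards [(memLp_top_of_bound hm.aestronglyMeasurable 1
    (Filter.Eventually.of_forall hb)).coeFn_toLp] with x hx
  rw [hx, Real.norm_eq_abs]
  simp only [hs]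
  split_ifs with h0
  · rw [mul_one, abs_of_nonneg h0]
  · rw [mul_neg_one, abs_of_neg (not_le.1 h0)]

end

end MeasureTheory

/-! ### Segments from the root separate the points of `L_∞(μ)` -/

namespace RTree

open Filter

noncomputable section

variable {T : Type*} [MetricSpace T] [RTree T]

/-- By density `g` annihilates all of `L₁(μ)`. Testing on subsets of a segment, which has finite
measure, gives `g = 0` almost everywhere there, and nullness on all these segments suffices. -/
theorem eq_zero_of_l1Pairing_seg {A : Set T} {o : T} (hbr : branchingPoints T ⊆ closure A)
    (ho : o ∈ closure A) {g : Lp ℝ ∞ (treeMeasure o (closure A))}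
    (h : ∀ a ∈ A, l1Pairing _ (indL1 (treeMeasure o (closure A)) (seg o a)) g = 0) : g = 0 := by
  let μ := treeMeasure o (closure A)
  have hall : ∀ f, l1Pairing μ f g = 0 := by
    have hker := eq_top_of_indL1_seg_mem_of_closure hbr ho
      (V := LinearMap.ker ((l1Pairing μ).flip g).toLinearMap)
      (ContinuousLinearMap.isClosed_ker _) fun a ha => by
        simpa using h a ha
    intro f
    have hf : f ∈ LinearMap.ker ((l1Pairing μ).flip g).toLinearMap := hker ▸ Submodule.mem_top
    simpa using hf
  have hms : MeasurableSet {x | g x ≠ 0} :=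
    (Lp.stronglyMeasurable g).measurable (measurableSet_singleton (0 : ℝ)).compl
  refine (Lp.eq_zero_iff_ae_eq_zero (f := g)).2 ?_
  change μ {x | g x ≠ 0} = 0
  refine treeMeasure_eq_zero_of_forall_seg isClosed_closure ho hms fun a _ => ?_
  have hfin := treeMeasure_seg_ne_top isClosed_closure ho a
  have h0 : g =ᵐ[μ.restrict (seg o a)] 0 := by
    refine Integrable.ae_eq_zero_of_forall_setIntegral_eq_zero (integrableOn_of_top hfin g) ?_
    intro B hB _
    rw [Measure.restrict_restrict hB, ← l1Pairing_indL1 (hB.inter (measurableSet_seg o a))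
      (ne_top_of_le_ne_top hfin (measure_mono inter_subset_right)), hall]
  rw [← Measure.restrict_apply hms]
  exact h0

/-! ### The isometry onto the Lipschitz functions -/

section Isometry

variable (A : Set T) (o : A) (hbr : branchingPoints T ⊆ closure A)

/-- The operator `g ↦ (a ↦ ∫_{[o,a]} g dμ)` from `L_∞(μ)` to `Lip₀(A)`. -/
def primitive : Lp ℝ ∞ (treeMeasure (o : T) (closure A)) →ₗ[ℝ] Lip0 A o where
  toFun g := ⟨fun a => l1Pairing _ (indL1 _ (seg (o : T) a)) g, by
    have ho := subset_closure o.2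
    refine ⟨?_, ‖g‖, norm_nonneg g, fun x y => ?_⟩
    · beta_reduce
      -- The value at the base point vanishes because the root carries no mass.
      rw [indL1_of_measure_eq_zero (measurableSet_seg _ _) (by
        rw [treeMeasure_seg isClosed_closure ho ho, dist_self, ENNReal.ofReal_zero])]
      simp
    · rw [← sub_apply, ← map_sub, mul_comm]
      refine (abs_l1Pairing_le _ _).trans (mul_le_mul_of_nonneg_right ?_ (norm_nonneg g))
      rw [Subtype.dist_eq, dist_comm]
      exact norm_indL1_seg_sub_le isClosed_closure hbr ho (subset_closure y.2)
        (subset_closure x.2)⟩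
  map_add' g g' := Lip0.ext' fun a => map_add _ g g'
  map_smul' c g := Lip0.ext' fun a => map_smul _ c g

theorem primitive_apply (g : Lp ℝ ∞ (treeMeasure (o : T) (closure A))) (a : A) :
    primitive A o hbr g a = l1Pairing _ (indL1 _ (seg (o : T) a)) g := rfl

theorem primitive_eq_integral (g : Lp ℝ ∞ (treeMeasure (o : T) (closure A))) (a : A) :
    primitive A o hbr g a = ∫ x in seg (o : T) a, g x ∂(treeMeasure (o : T) (closure A)) := by
  rw [primitive_apply, l1Pairing_indL1 (measurableSet_seg _ _)
    (treeMeasure_seg_ne_top isClosed_closure (subset_closure o.2) _)]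

theorem norm_primitive_le (g : Lp ℝ ∞ (treeMeasure (o : T) (closure A))) :
    ‖primitive A o hbr g‖ ≤ ‖g‖ := by
  refine Lip0.lip_le _ (norm_nonneg g) fun x y => ?_
  rw [primitive_apply, primitive_apply, ← sub_apply, ← map_sub, mul_comm]
  refine (abs_l1Pairing_le _ _).trans (mul_le_mul_of_nonneg_right ?_ (norm_nonneg g))
  rw [Subtype.dist_eq, dist_comm]
  exact norm_indL1_seg_sub_le isClosed_closure hbr (subset_closure o.2) (subset_closure y.2)
    (subset_closure x.2)

theorem primitive_injective : Function.Injective (primitive A o hbr) := by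
  refine (injective_iff_map_eq_zero _).2 fun g hg => ?_
  refine eq_zero_of_l1Pairing_seg hbr (subset_closure o.2) fun a ha => ?_
  rw [← primitive_apply A o hbr g ⟨a, ha⟩, hg]
  rfl

/-- The density is the `rootSlope` of an extension of `f` to `T` with the same Lipschitz constant,
which bounds it everywhere. -/
theorem exists_primitive_eq (f : Lip0 A o) :
    ∃ g : Lp ℝ ∞ (treeMeasure (o : T) (closure A)), primitive A o hbr g = f ∧ ‖g‖ ≤ ‖f‖ := by
  have ho : (o : T) ∈ closure A := subset_closure o.2
  set K : ℝ≥0 := ⟨‖f‖, norm_nonneg f⟩ with hK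
  -- The extension by `0` only makes `f` a function on `T`; the values off `A` play no role.
  have hlip : LipschitzOnWith K (Function.extend Subtype.val (fun a : A => f a) 0) A := by
    refine LipschitzOnWith.of_dist_le_mul fun x hx y hy => ?_
    have hx' := Subtype.val_injective.extend_apply (fun a : A => f a) 0 ⟨x, hx⟩
    have hy' := Subtype.val_injective.extend_apply (fun a : A => f a) 0 ⟨y, hy⟩
    simp only at hx' hy'
    rw [hx', hy', Real.dist_eq, dist_comm]
    exact Lip0.abs_sub_le f ⟨y, hy⟩ ⟨x, hx⟩
  obtain ⟨F, hF, hFf⟩ := hlip.extend_real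
  have hFa : ∀ a : A, F a = f a := fun a => by
    rw [← hFf a.2, Subtype.val_injective.extend_apply]
  have hm := (measurable_rootSlope ho hF.continuous).aestronglyMeasurable
    (μ := treeMeasure (o : T) (closure A))
  have hb : ∀ x, |rootSlope (o : T) (closure A) F x| ≤ ‖f‖ := abs_rootSlope_le hF _
  refine ⟨(memLp_top_of_bound hm ‖f‖ (Eventually.of_forall hb)).toLp _, Lip0.ext' fun a => ?_,
    norm_toLp_top_le hm (norm_nonneg f) hb⟩
  rw [primitive_eq_integral, integral_congr_ae (ae_restrict_of_ae (MemLp.coeFn_toLp _)),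
    integral_rootSlope isClosed_closure ho hF (subset_closure a.2), hFa, hFa, Lip0.apply_base,
    sub_zero]

/-- The lower bound comes from injectivity: the preimage of norm at most `‖primitive A o hbr g‖` can
only be `g`. -/
theorem norm_primitive (g : Lp ℝ ∞ (treeMeasure (o : T) (closure A))) :
    ‖primitive A o hbr g‖ = ‖g‖ := by
  refine le_antisymm (norm_primitive_le A o hbr g) ?_
  obtain ⟨g', hg', hle⟩ := exists_primitive_eq A o hbr (primitive A o hbr g)
  rwa [primitive_injective A o hbr hg'] at hle

/-- The linear isometry `g ↦ (a ↦ ∫_{[o,a]} g dμ)` of `L_∞(μ)` onto `Lip₀(A)`. -/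
def primitiveEquiv : Lp ℝ ∞ (treeMeasure (o : T) (closure A)) ≃ₗᵢ[ℝ] Lip0 A o :=
  LinearIsometryEquiv.ofSurjective ⟨primitive A o hbr, norm_primitive A o hbr⟩ fun f =>
    (exists_primitive_eq A o hbr f).imp fun _ h => h.1

theorem primitiveEquiv_apply (g : Lp ℝ ∞ (treeMeasure (o : T) (closure A))) :
    primitiveEquiv A o hbr g = primitive A o hbr g := rfl

/-! ### The isometry of the Lipschitz-free space -/

/-- The action of `L₁(μ)` on `Lip₀(A)`, identified with `L_∞(μ)`. -/
def predualMap : Lp ℝ 1 (treeMeasure (o : T) (closure A)) →ₗᵢ[ℝ] StrongDual ℝ (Lip0 A o) where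
  toFun h := (l1Pairing _ h).comp
    ((primitiveEquiv A o hbr).symm.toContinuousLinearEquiv : Lip0 A o →L[ℝ] _)
  map_add' h h' := by
    rw [map_add, ContinuousLinearMap.add_comp]
  map_smul' c h := by
    rw [map_smul, ContinuousLinearMap.smul_comp, RingHom.id_apply]
  norm_map' h := by
    refine le_antisymm (ContinuousLinearMap.opNorm_le_bound _ (norm_nonneg h) fun f => ?_) ?_
    · have := abs_l1Pairing_le h ((primitiveEquiv A o hbr).symm f)
      rwa [LinearIsometryEquiv.norm_map] at this
    -- The function norming `h` in the unit ball of `L_∞(μ)` is carried by `primitiveEquiv` into the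
    -- unit ball of `Lip₀(A)`.
    · obtain ⟨g, hg, hgh⟩ := exists_l1Pairing_eq_norm h
      have hle := ContinuousLinearMap.le_opNorm ((l1Pairing _ h).comp
        ((primitiveEquiv A o hbr).symm.toContinuousLinearEquiv : Lip0 A o →L[ℝ] _))
        (primitiveEquiv A o hbr g)
      have hval : ((l1Pairing _ h).comp
        ((primitiveEquiv A o hbr).symm.toContinuousLinearEquiv : Lip0 A o →L[ℝ] _))
        (primitiveEquiv A o hbr g) = ‖h‖ := by
        rw [← hgh]
        exact congrArg (l1Pairing _ h) ((primitiveEquiv A o hbr).symm_apply_apply g)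
      rw [hval, norm_norm, LinearIsometryEquiv.norm_map] at hle
      exact hle.trans (mul_le_of_le_one_right (norm_nonneg _) hg)

theorem predualMap_apply (h : Lp ℝ 1 (treeMeasure (o : T) (closure A)))
    (g : Lp ℝ ∞ (treeMeasure (o : T) (closure A))) :
    predualMap A o hbr h (primitiveEquiv A o hbr g) = l1Pairing _ h g :=
  congrArg (l1Pairing _ h) ((primitiveEquiv A o hbr).symm_apply_apply g)

theorem predualMap_indL1_seg (a : A) :
    predualMap A o hbr (indL1 _ (seg (o : T) a)) = Lip0.eval o a := by
  ext f
  obtain ⟨g, rfl⟩ := (primitiveEquiv A o hbr).surjective f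
  rw [predualMap_apply, Lip0.eval_apply, primitiveEquiv_apply, primitive_apply]

/-- Both inclusions rest on `1_[o,a] ↦ δ_a`. The preimage of the free space is a closed subspace
containing all `1_[o,a]`, hence everything; the range, being an isometric image of a complete space,
is closed and contains all `δ_a`. -/
theorem range_predualMap : (predualMap A o hbr).range = LipFree A o := by
  apply le_antisymm
  · have htop := eq_top_of_indL1_seg_mem_of_closure hbr (subset_closure o.2)
      (V := (LipFree A o).comap (predualMap A o hbr).toLinearMap)
      ((Submodule.isClosed_topologicalClosure _).preimage (predualMap A o hbr).continuous)
      fun a ha => by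
        change predualMap A o hbr (indL1 _ (seg (o : T) a)) ∈ LipFree A o
        rw [predualMap_indL1_seg A o hbr ⟨a, ha⟩]
        exact Submodule.le_topologicalClosure _ (Submodule.subset_span (mem_range_self _))
    rintro _ ⟨h, rfl⟩
    have : h ∈ (LipFree A o).comap (predualMap A o hbr).toLinearMap := htop ▸ Submodule.mem_top
    exact this
  · refine Submodule.topologicalClosure_minimal _ (Submodule.span_le.2 ?_) ?_
    · rintro _ ⟨a, rfl⟩
      exact ⟨_, predualMap_indL1_seg A o hbr a⟩
    · exact (predualMap A o hbr).isometry.isClosedEmbedding.isClosed_range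

end Isometry

end

end RTree

theorem theorem3p2 {T : Type*} [MetricSpace T] [RTree T] (A : Set T) (o : A)
    (hA : RTree.branchingPoints T ⊆ closure A) :
    ∃ (J : LipFree A o ≃ₗᵢ[ℝ] Lp ℝ 1 (RTree.treeMeasure (o : T) (closure A)))
      (Φ : Lp ℝ ∞ (RTree.treeMeasure (o : T) (closure A)) ≃ₗᵢ[ℝ] Lip0 A o),
      (∀ (g : Lp ℝ ∞ (RTree.treeMeasure (o : T) (closure A))) (a : A),
        IntegrableOn g (RTree.seg (o : T) a) (RTree.treeMeasure (o : T) (closure A)) ∧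
        Φ g a = ∫ x in RTree.seg (o : T) a, g x ∂(RTree.treeMeasure (o : T) (closure A))) ∧
      ∀ (α : LipFree A o) (g : Lp ℝ ∞ (RTree.treeMeasure (o : T) (closure A))),
        (α : StrongDual ℝ (Lip0 A o)) (Φ g)
          = ∫ x, J α x * g x ∂(RTree.treeMeasure (o : T) (closure A)) := by
  -- `J` is the inverse of `predualMap`, corestricted to its range, so the transposition formula is
  -- `predualMap_apply`.
  let I : Lp ℝ 1 (RTree.treeMeasure (o : T) (closure A)) ≃ₗᵢ[ℝ] LipFree A o :=
    (RTree.predualMap A o hA).equivRange.trans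
      (LinearIsometryEquiv.ofEq _ _ (RTree.range_predualMap A o hA))
  have hI : ∀ h, (I h : StrongDual ℝ (Lip0 A o)) = RTree.predualMap A o hA h := fun _ => rfl
  refine ⟨I.symm, RTree.primitiveEquiv A o hA, fun g a => ⟨integrableOn_of_top
    (RTree.treeMeasure_seg_ne_top isClosed_closure (subset_closure o.2) _) g,
    RTree.primitive_eq_integral A o hA g a⟩, fun α g => ?_⟩
  obtain ⟨h, rfl⟩ := I.surjective α
  rw [hI, RTree.predualMap_apply, l1Pairing_apply, I.symm_apply_apply]
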